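/- Let $L:[0,\infty)\to[0,\infty)$ be a (measurable, deterministic) path loss function with $L(r)\le L_0:=L(0)<\infty$ for all $r\ge 0$ and $\gamma:=\int_0^\infty rL(r)\,dr\in(0,\infty)$. Suppose that there are $r_0\ge 0$ and $\zeta>0$ such that $L$ is non-increasing and differentiable on $[r_0,\infty)$ (one-sidedly at $r_0$) and 1. $\dfrac{rL(r)}{-L'(r)}\ge\zeta$ for all $r\in[r_0,\infty)$, in the sense that $\zeta\,(-L'(r))\le rL(r)$; 2. for some $\lambda_c\ge 0$, $\displaystyle\int_{r_0}^\infty \frac{r}{L(r)^2}\,e^{-\pi\lambda_0 r^2}\,dr<\infty$ for all $\lambda_0>\lambda_c$ (the integrand being $\infty$ where $L(r)=0$, $r>0$). Let the fading power $h$ have an arbitrary law on $[0,\infty)$ with $\mathbb E[h]=1$. For $\lambda>0$ let base stations be located at the points of a homogeneous Poisson point process $\Phi$ of intensity $\lambda$ in the plane, with i.i.d. fading powers distributed as $h$ and independent of $\Phi$. Let $R$ be the distance from the origin to the closest point of $\Phi$, let $h_0$ be the fading power of that point, and let $\mathcal I=\sum h_iL(r_i)$, where the sum runs over the points of $\Phi$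 at distance $r_i>R$ from the origin, with fading powers $h_i$. Then: (a) There is $\lambda_1\ge 0$ such that for all $\lambda_0\ge\lambda_1$ $$\int_0^\infty\!\!\int_0^\infty 2\pi\lambda_0\, r\,t\,\exp\Big(-\pi\lambda_0r^2-2\pi\lambda_0\int_r^\infty x\,\mathbb E_h\big[1-e^{-htL(x)}\big]\,dx\Big)\,dr\,dt<\infty .$$ (b) There is $\lambda_2>0$ such that $\mathbb E[\mathcal I^{-2}]<\infty$ for every intensity $\lambda\ge\lambda_2$. (c) If moreover $L$ is right-continuous at $0$, then for every noise power $N_0\ge 0$ the average area spectral efficiency $$\lambda\,\mathbb E\big[\log_2(1+\mathrm{SINR})\big],\qquad \mathrm{SINR}=\frac{h_0L(R)}{\mathcal I+N_0},$$ converges, as $\lambda\to\infty$, to $\dfrac{L_0}{2\pi\ln(2)\,\gamma}$, which does not depend on the law of $h$. The constants $\lambda_1,\lambda_2$ may depend on $L$ and on the law of $h$. -/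

import Mathlib

open MeasureTheory ProbabilityTheory Filter Topology Set
open scoped ENNReal NNReal

noncomputable section

namespace UltraDense

/-- The Euclidean plane, with its Euclidean norm and Lebesgue measure. -/
abbrev Plane : Type := EuclideanSpace ℝ (Fin 2)

/-! ### Path loss and fading -/

/-- The constant `γ = ∫₀^∞ r L(r) dr`. -/
def pathLossGamma (L : ℝ → ℝ) : ℝ := ∫ r in Ioi (0 : ℝ), r * L r

/-- Physically feasible (deterministic) path loss functions. Only the values of `L` on `[0, ∞)`
matter. -/
structure PhysicallyFeasible (L : ℝ → ℝ) : Prop where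
  measurable : Measurable L
  nonneg : ∀ r, 0 ≤ r → 0 ≤ L r
  le_zero : ∀ r, 0 ≤ r → L r ≤ L 0
  integrable : IntegrableOn (fun r => r * L r) (Ioi 0)
  gamma_pos : 0 < pathLossGamma L

/-- The law of a fading power: a probability law on `[0, ∞)` with mean one. -/
structure UnitMeanFading (H : Measure ℝ) : Prop where
  isProbabilityMeasure : IsProbabilityMeasure H
  nonneg : ∀ᵐ y ∂H, 0 ≤ y
  integrable : Integrable (fun y => y) H
  mean_one : ∫ y, y ∂H = 1

/-- The simple conditions on the path loss. The derivative at the left end point `r₀` is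
one-sided. The condition `r L(r) / (-L'(r)) ≥ ζ` is written with the denominator cleared, so it
also allows `L'(r) = 0`. The integral of `r e^{-π λ₀ r²} / L(r)²` is `[0, ∞]`-valued, and the
integrand is `∞` where `L(r) = 0 < r`. -/
def SimpleConditions (L : ℝ → ℝ) : Prop :=
  ∃ r₀ : ℝ, 0 ≤ r₀ ∧ ∃ ζ : ℝ, 0 < ζ ∧
    AntitoneOn L (Ici r₀) ∧ DifferentiableOn ℝ L (Ici r₀) ∧
    (∀ r ∈ Ici r₀, ζ * (-derivWithin L (Ici r₀) r) ≤ r * L r) ∧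
    ∃ lamc : ℝ, 0 ≤ lamc ∧ ∀ lam₀ : ℝ, lamc < lam₀ →
      ∫⁻ r in Ioi r₀,
        ENNReal.ofReal (r * Real.exp (-Real.pi * lam₀ * r ^ 2)) / ENNReal.ofReal (L r) ^ 2 < ∞

/-- `∫₀^∞ ∫₀^∞ 2πλ₀ r t exp(-πλ₀ r² - 2πλ₀ ∫_r^∞ x E_h[1 - e^{-h t L(x)}] dx) dr dt`, as an
element of `[0, ∞]`. -/
def laplaceIntegral (L : ℝ → ℝ) (H : Measure ℝ) (lam₀ : ℝ) : ℝ≥0∞ :=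
  ∫⁻ t in Ioi (0 : ℝ), ∫⁻ r in Ioi (0 : ℝ),
    ENNReal.ofReal (2 * Real.pi * lam₀ * r * t *
      Real.exp (-Real.pi * lam₀ * r ^ 2 -
        2 * Real.pi * lam₀ *
          ∫ x in Ioi r, x * ∫ y, (1 - Real.exp (-(y * t * L x))) ∂H))

/-! ### The Poisson network -/

section Network

variable {Ω : Type*} [MeasurableSpace Ω]

/-- The number of points of the configuration `X 0 ω, X 1 ω, …` in `B`. -/
def pointCount (X : ℕ → Ω → Plane) (B : Set Plane) (ω : Ω) : ℝ≥0∞ :=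
  ∑' i, B.indicator (fun _ => (1 : ℝ≥0∞)) (X i ω)

/-- `X 0, X 1, …` is an enumeration of the points of a homogeneous Poisson point process on the
plane with intensity `lam` (for `lam > 0` there are almost surely infinitely many points). -/
structure IsPoissonProcess (P : Measure Ω) (lam : ℝ) (X : ℕ → Ω → Plane) : Prop where
  measurable : ∀ i, Measurable (X i)
  count_law : ∀ B : Set Plane, MeasurableSet B → volume B < ∞ →
    P.map (pointCount X B) =
      (poissonMeasure (lam * (volume B).toReal).toNNReal).map (fun n : ℕ => (n : ℝ≥0∞))
  count_indep : ∀ B : ℕ → Set Plane, (∀ j, MeasurableSet (B j)) → (∀ j, volume (B j) < ∞) →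
    Pairwise (fun j k => Disjoint (B j) (B k)) → iIndepFun (fun j => pointCount X (B j)) P

/-- Base stations at the points `X i` of a Poisson point process of intensity `lam`, with
independent fading powers `h i` of law `H`, independent of the positions. -/
structure IsCellularNetwork (P : Measure Ω) (lam : ℝ) (H : Measure ℝ)
    (X : ℕ → Ω → Plane) (h : ℕ → Ω → ℝ) : Prop where
  isProbabilityMeasure : IsProbabilityMeasure P
  poisson : IsPoissonProcess P lam X
  fading_measurable : ∀ i, Measurable (h i)
  fading_law : ∀ i, P.map (h i) = H
  fading_indep : iIndepFun h P
  indep : IndepFun (fun ω i => X i ω) (fun ω i => h i ω) P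

/-- The index of the base station serving the user at the origin: the closest one (almost surely
there is exactly one). -/
def servingIndex (X : ℕ → Ω → Plane) (ω : Ω) : ℕ :=
  sInf {i | ∀ j, ‖X i ω‖ ≤ ‖X j ω‖}

/-- The distance from the origin to the serving base station. -/
def servingDist (X : ℕ → Ω → Plane) (ω : Ω) : ℝ := ‖X (servingIndex X ω) ω‖

/-- The interference at the origin: the total power received from the points outside the closed
ball around the origin through the serving base station. -/
def interference (L : ℝ → ℝ) (X : ℕ → Ω → Plane) (h : ℕ → Ω → ℝ) (ω : Ω) : ℝ≥0∞ :=
  ∑' i, {i | servingDist X ω < ‖X i ω‖}.indicator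
    (fun i => ENNReal.ofReal (h i ω * L ‖X i ω‖)) i

/-- The second negative moment `E[1 / I²]` of the interference, in `[0, ∞]`. -/
def secondNegativeMoment (P : Measure Ω) (L : ℝ → ℝ) (X : ℕ → Ω → Plane) (h : ℕ → Ω → ℝ) :
    ℝ≥0∞ :=
  ∫⁻ ω, (interference L X h ω ^ 2)⁻¹ ∂P

/-- The signal-to-interference-plus-noise ratio of the user at the origin. -/
def sinr (L : ℝ → ℝ) (N₀ : ℝ) (X : ℕ → Ω → Plane) (h : ℕ → Ω → ℝ) (ω : Ω) : ℝ≥0∞ :=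
  ENNReal.ofReal (h (servingIndex X ω) ω * L (servingDist X ω)) /
    (interference L X h ω + ENNReal.ofReal N₀)

/-- The average area spectral efficiency `λ E[log₂(1 + SINR)]`, in `[0, ∞]`. -/
def averageASE (P : Measure Ω) (lam : ℝ) (L : ℝ → ℝ) (N₀ : ℝ) (X : ℕ → Ω → Plane)
    (h : ℕ → Ω → ℝ) : ℝ≥0∞ :=
  ENNReal.ofReal lam *
    ∫⁻ ω, ENNReal.ofReal (Real.logb 2 (1 + (sinr L N₀ X h ω).toReal)) ∂P

end Network

end UltraDense

end

/-! Write `φ(v) = E[e^{-vh}]`, `q = 1 - φ(1) > 0` and `G = 2πγ`. Two facts carry everything: a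
Gaussian lower bound on the path loss, and exponential lower-tail bounds for Poisson shot noise.

Since `L` is eventually non-increasing, finiteness of the integral of `r e^{-πλ₀r²} / L(r)²` over
unit intervals forces `L(r) ≥ c e^{-Kr²}` for large `r` (`SimpleConditions.exists_gaussian_le`). The
probability that a disc of radius `s` is empty, or that an annulus of that scale has little power,
is `O(e^{-λqπs²})`. For large `λ` the second Gaussian beats the first.

For the second negative moment this comparison is made on dyadic radii, which gives a bound uniform
in `λ` (`exists_secondNegativeMoment_le`). For the double integral it is made in the exponent: `tL ≥
1` up to a radius `s` with `Ks² = log(tc)`, so the exponential decays like `t⁻³`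
(`le_integral_one_sub_exp`).

For the limit, `λ log(1 + SINR)` is close to `λ SINR`, the serving distance tends to `0`, and
`interference / λ` concentrates at `G`. The fading power of the serving station has mean one, so
only `L(0) / (G log 2)` remains. Since `h` may have infinite variance, Chebyshev's inequality is not
available. Instead, Chernoff's bound makes the lower tail exponentially small
(`exists_measure_interference_le`), using only `(1 - φ(t)) / t → 1`; the upper tail then follows
from the mean given by Campbell's formula (`IsCellularNetwork.measure_interference_gt_le`).

The upper bound on the efficiency must control the event of small interference, where the SINR is
large: there the logarithm costs at most `O(λ³)` plus `O(1/λ)` times integrable quantities, which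
the exponential tail and the uniform negative moment absorb (`IsCellularNetwork.averageASE_le`). The
lower bound truncates the serving fading power (`IsCellularNetwork.le_averageASE`). -/

noncomputable section

namespace UltraDense

/-! ### The Laplace transform of the fading law -/

/-- The Laplace transform `E[e^{-v h}]` of the fading law. -/
def fadingLaplace (H : Measure ℝ) (v : ℝ) : ℝ := ∫ y, Real.exp (-(v * y)) ∂H

section Laplace

variable {H : Measure ℝ}

lemma UnitMeanFading.integrable_exp (hH : UnitMeanFading H) {v : ℝ} (hv : 0 ≤ v) :
    Integrable (fun y => Real.exp (-(v * y))) H := by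
  have := hH.isProbabilityMeasure
  refine Integrable.of_bound (C := 1) (by fun_prop) ?_
  filter_upwards [hH.nonneg] with y hy
  rw [Real.norm_of_nonneg (Real.exp_pos _).le]
  exact Real.exp_le_one_iff.2 (by nlinarith)

lemma UnitMeanFading.fadingLaplace_pos (hH : UnitMeanFading H) {v : ℝ} (hv : 0 ≤ v) :
    0 < fadingLaplace H v := by
  have := hH.isProbabilityMeasure
  exact integral_exp_pos (hH.integrable_exp hv)

lemma UnitMeanFading.fadingLaplace_anti (hH : UnitMeanFading H) {u v : ℝ} (hu : 0 ≤ u)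
    (huv : u ≤ v) : fadingLaplace H v ≤ fadingLaplace H u := by
  refine integral_mono_ae (hH.integrable_exp (hu.trans huv)) (hH.integrable_exp hu) ?_
  filter_upwards [hH.nonneg] with y hy
  exact Real.exp_le_exp.2 (by nlinarith)

lemma UnitMeanFading.fadingLaplace_zero (hH : UnitMeanFading H) : fadingLaplace H 0 = 1 := by
  have := hH.isProbabilityMeasure
  simp [fadingLaplace]

lemma UnitMeanFading.fadingLaplace_le_one (hH : UnitMeanFading H) {v : ℝ} (hv : 0 ≤ v) :
    fadingLaplace H v ≤ 1 :=
  hH.fadingLaplace_zero ▸ hH.fadingLaplace_anti le_rfl hv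

lemma UnitMeanFading.one_sub_fadingLaplace (hH : UnitMeanFading H) {v : ℝ} (hv : 0 ≤ v) :
    1 - fadingLaplace H v = ∫ y, (1 - Real.exp (-(v * y))) ∂H := by
  have := hH.isProbabilityMeasure
  rw [integral_sub (integrable_const _) (hH.integrable_exp hv)]
  simp [fadingLaplace]

lemma UnitMeanFading.one_sub_fadingLaplace_le (hH : UnitMeanFading H) {v : ℝ} (hv : 0 ≤ v) :
    1 - fadingLaplace H v ≤ v := by
  have := hH.isProbabilityMeasure
  rw [hH.one_sub_fadingLaplace hv]
  calc ∫ y, (1 - Real.exp (-(v * y))) ∂H ≤ ∫ y, v * y ∂H := by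
        refine integral_mono ((integrable_const _).sub (hH.integrable_exp hv))
          (hH.integrable.const_mul v) fun y => ?_
        have := Real.add_one_le_exp (-(v * y))
        simp only
        linarith
    _ = v := by rw [integral_const_mul, hH.mean_one, mul_one]

/-- Equality would force `h = 0` almost surely, against mean one. The gap `q = 1 - fadingLaplace H
1` is the rate in all the estimates at a fixed scale. -/
lemma UnitMeanFading.fadingLaplace_one_lt (hH : UnitMeanFading H) : fadingLaplace H 1 < 1 := by
  have := hH.isProbabilityMeasure
  by_contra hcon
  have h0 : ∫ y, (1 - Real.exp (-(1 * y))) ∂H ≤ 0 := by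
    rw [← hH.one_sub_fadingLaplace zero_le_one]; linarith
  have hnn : 0 ≤ᵐ[H] fun y => 1 - Real.exp (-(1 * y)) := by
    filter_upwards [hH.nonneg] with y hy
    have : Real.exp (-(1 * y)) ≤ 1 := Real.exp_le_one_iff.2 (by linarith)
    simp only [Pi.zero_apply]; linarith
  have hint : Integrable (fun y => 1 - Real.exp (-(1 * y))) H :=
    (integrable_const _).sub (hH.integrable_exp zero_le_one)
  have hz := (integral_eq_zero_iff_of_nonneg_ae hnn hint).1 (le_antisymm h0 (integral_nonneg_of_ae hnn))
  have hy0 : (fun y : ℝ => y) =ᵐ[H] fun _ => 0 := by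
    filter_upwards [hz] with y hy
    simp only [Pi.zero_apply] at hy
    have : Real.exp (-(1 * y)) = 1 := by linarith
    rw [Real.exp_eq_one_iff] at this
    linarith
  have := hH.mean_one
  rw [integral_congr_ae hy0] at this
  simp at this

lemma UnitMeanFading.measurable_fadingLaplace (hH : UnitMeanFading H) :
    Measurable (fadingLaplace H) := by
  have := hH.isProbabilityMeasure
  have : StronglyMeasurable (Function.uncurry fun (v : ℝ) (y : ℝ) => Real.exp (-(v * y))) :=
    Measurable.stronglyMeasurable (by fun_prop)
  exact (this.integral_prod_right).measurable

lemma UnitMeanFading.lintegral_ofReal_exp (hH : UnitMeanFading H) {v : ℝ} (hv : 0 ≤ v) :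
    ∫⁻ y, ENNReal.ofReal (Real.exp (-(v * y))) ∂H = ENNReal.ofReal (fadingLaplace H v) :=
  (ofReal_integral_eq_lintegral_ofReal (hH.integrable_exp hv)
    (ae_of_all _ fun _ => (Real.exp_pos _).le)).symm

lemma UnitMeanFading.lintegral_ofReal (hH : UnitMeanFading H) :
    ∫⁻ y, ENNReal.ofReal y ∂H = 1 := by
  rw [← ofReal_integral_eq_lintegral_ofReal hH.integrable hH.nonneg, hH.mean_one,
    ENNReal.ofReal_one]

end Laplace

/-! ### Counting variables of a Poisson process -/

section Counts

lemma lintegral_exp_neg_poissonMeasure (r : ℝ≥0) (c : ℝ) :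
    ∫⁻ n : ℕ, ENNReal.ofReal (Real.exp (-(c * n))) ∂(poissonMeasure r) =
      ENNReal.ofReal (Real.exp (-(r * (1 - Real.exp (-c))))) := by
  have hs : HasSum (fun n : ℕ => Real.exp (-r) * ((r * Real.exp (-c)) ^ n / n.factorial))
      (Real.exp (-r) * Real.exp (r * Real.exp (-c))) := by
    rw [Real.exp_eq_exp_ℝ]
    exact (NormedSpace.expSeries_div_hasSum_exp (r * NormedSpace.exp (-c) : ℝ)).mul_left _
  have : Real.exp (-(r * (1 - Real.exp (-c)))) = Real.exp (-r) * Real.exp (r * Real.exp (-c)) := by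
    rw [← Real.exp_add]; ring_nf
  rw [this, ← hs.tsum_eq, ENNReal.ofReal_tsum_of_nonneg (fun n => by positivity) hs.summable,
    poissonMeasure, lintegral_sum_measure]
  congr with n
  rw [lintegral_smul_measure, lintegral_dirac, smul_eq_mul,
    ← ENNReal.ofReal_mul (by positivity), mul_pow, ← Real.exp_nat_mul]
  congr 1
  rw [show -(c * (n : ℝ)) = n * -c by ring]
  ring

lemma lintegral_natCast_poissonMeasure (r : ℝ≥0) :
    ∫⁻ n : ℕ, (n : ℝ≥0∞) ∂(poissonMeasure r) = r := by
  have hs : HasSum (fun n : ℕ => Real.exp (-r) * r * ((r : ℝ) ^ n / n.factorial))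
      (Real.exp (-r) * r * Real.exp r) := by
    rw [Real.exp_eq_exp_ℝ]
    exact (NormedSpace.expSeries_div_hasSum_exp (r : ℝ)).mul_left _
  have hr : Real.exp (-r) * r * Real.exp r = r := by
    rw [mul_right_comm, ← Real.exp_add]; simp
  rw [hr] at hs
  rw [poissonMeasure, lintegral_sum_measure, tsum_eq_zero_add' ENNReal.summable]
  have : ∀ n : ℕ, ∫⁻ m : ℕ, (m : ℝ≥0∞) ∂(ENNReal.ofReal (Real.exp (-r) * (r : ℝ) ^ (n + 1) /
      (n + 1).factorial) • Measure.dirac (n + 1)) =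
      ENNReal.ofReal (Real.exp (-r) * r * ((r : ℝ) ^ n / n.factorial)) := fun n => by
    rw [lintegral_smul_measure, lintegral_dirac, smul_eq_mul, ← ENNReal.ofReal_natCast,
      ← ENNReal.ofReal_mul (by positivity)]
    congr 1
    rw [Nat.factorial_succ]
    push_cast
    field_simp
    ring
  simp_rw [this]
  rw [← ENNReal.ofReal_tsum_of_nonneg (fun n => by positivity) hs.summable, hs.tsum_eq]
  simp

variable {Ω : Type*} [MeasurableSpace Ω] {P : Measure Ω} {lam : ℝ} {X : ℕ → Ω → Plane}

lemma IsPoissonProcess.measurable_pointCount (hX : IsPoissonProcess P lam X) {B : Set Plane}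
    (hB : MeasurableSet B) : Measurable (pointCount X B) :=
  Measurable.tsum fun i => (measurable_const.indicator hB).comp (hX.measurable i)

lemma IsPoissonProcess.lintegral_comp_pointCount (hX : IsPoissonProcess P lam X) {B : Set Plane}
    (hB : MeasurableSet B) (hBf : volume B < ∞) {f : ℝ≥0∞ → ℝ≥0∞} (hf : Measurable f) :
    ∫⁻ ω, f (pointCount X B ω) ∂P =
      ∫⁻ n : ℕ, f n ∂(poissonMeasure (lam * (volume B).toReal).toNNReal) := by
  rw [← lintegral_map hf (hX.measurable_pointCount hB), hX.count_law B hB hBf,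
    lintegral_map hf (by fun_prop)]

lemma IsPoissonProcess.ae_pointCount_lt_top (hX : IsPoissonProcess P lam X) {B : Set Plane}
    (hB : MeasurableSet B) (hBf : volume B < ∞) : ∀ᵐ ω ∂P, pointCount X B ω < ∞ := by
  have h : ∀ᵐ x ∂(P.map (pointCount X B)), x < ∞ := by
    rw [hX.count_law B hB hBf, ae_map_iff (by fun_prop) measurableSet_Iio]
    exact ae_of_all _ fun n => ENNReal.natCast_lt_top n
  exact ae_of_ae_map (hX.measurable_pointCount hB).aemeasurable h

lemma IsPoissonProcess.measure_pointCount_eq_zero (hX : IsPoissonProcess P lam X) (hlam : 0 ≤ lam)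
    {B : Set Plane} (hB : MeasurableSet B) (hBf : volume B < ∞) :
    P {ω | pointCount X B ω = 0} = ENNReal.ofReal (Real.exp (-(lam * (volume B).toReal))) := by
  have : {ω | pointCount X B ω = 0} = pointCount X B ⁻¹' {0} := rfl
  rw [this, ← Measure.map_apply (hX.measurable_pointCount hB) (measurableSet_singleton _),
    hX.count_law B hB hBf, Measure.map_apply (by fun_prop) (measurableSet_singleton _)]
  have h2 : (fun n : ℕ => (n : ℝ≥0∞)) ⁻¹' {0} = {0} := by ext; simp
  rw [h2, poissonMeasure_singleton, Real.coe_toNNReal _ (by positivity)]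
  simp

lemma IsPoissonProcess.lintegral_exp_neg_pointCount (hX : IsPoissonProcess P lam X)
    (hlam : 0 ≤ lam) {B : Set Plane} (hB : MeasurableSet B) (hBf : volume B < ∞) (c : ℝ) :
    ∫⁻ ω, ENNReal.ofReal (Real.exp (-(c * (pointCount X B ω).toReal))) ∂P =
      ENNReal.ofReal (Real.exp (-(lam * (volume B).toReal * (1 - Real.exp (-c))))) := by
  rw [hX.lintegral_comp_pointCount hB hBf
    (f := fun x => ENNReal.ofReal (Real.exp (-(c * x.toReal)))) (by fun_prop)]
  simp only [ENNReal.toReal_natCast]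
  rw [lintegral_exp_neg_poissonMeasure, Real.coe_toNNReal _ (by positivity)]

/-- The intensity measure of the process. -/
lemma IsPoissonProcess.sum_map (hX : IsPoissonProcess P lam X) :
    Measure.sum (fun i => P.map (X i)) = ENNReal.ofReal lam • (volume : Measure Plane) := by
  have key : ∀ B : Set Plane, MeasurableSet B → volume B < ∞ →
      Measure.sum (fun i => P.map (X i)) B = ENNReal.ofReal lam * volume B := fun B hB hBf => by
    have h1 : ∫⁻ ω, pointCount X B ω ∂P = ENNReal.ofReal lam * volume B := by
      rw [hX.lintegral_comp_pointCount hB hBf (f := fun x => x) measurable_id,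
        lintegral_natCast_poissonMeasure]
      change ENNReal.ofReal (lam * (volume B).toReal) = _
      rw [ENNReal.ofReal_mul' ENNReal.toReal_nonneg, ENNReal.ofReal_toReal hBf.ne]
    rw [Measure.sum_apply _ hB, ← h1]
    unfold pointCount
    rw [MeasureTheory.lintegral_tsum (f := fun i ω => B.indicator (fun _ => (1 : ℝ≥0∞)) (X i ω))
      fun i => ((measurable_const.indicator hB).comp (hX.measurable i)).aemeasurable]
    congr with i
    rw [Measure.map_apply (hX.measurable i) hB]
    rw [← lintegral_indicator_one (hX.measurable i hB)]
    rfl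
  ext s hs
  -- The law of the counts is only given on sets of finite volume, so a general set is exhausted by
  -- such sets.
  have hun : s = ⋃ n, s ∩ spanningSets volume n := by
    rw [← inter_iUnion, iUnion_spanningSets, inter_univ]
  have hmono : Monotone fun n => s ∩ spanningSets (volume : Measure Plane) n :=
    fun m n h => inter_subset_inter_right _ (monotone_spanningSets _ h)
  rw [hun, hmono.measure_iUnion, hmono.measure_iUnion]
  refine iSup_congr fun n => ?_
  rw [key _ (hs.inter (measurableSet_spanningSets _ _))
    ((measure_mono inter_subset_right).trans_lt (measure_spanningSets_lt_top _ _))]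
  rfl

/-- Campbell's formula. -/
lemma IsPoissonProcess.lintegral_tsum (hX : IsPoissonProcess P lam X) {f : Plane → ℝ≥0∞}
    (hf : Measurable f) :
    ∑' i, ∫⁻ ω, f (X i ω) ∂P = ENNReal.ofReal lam * ∫⁻ x, f x := by
  rw [← smul_eq_mul, ← lintegral_smul_measure, ← hX.sum_map, lintegral_sum_measure]
  congr with i
  rw [lintegral_map hf (hX.measurable i)]

/-- The exponential functional of a Poisson process at a simple function. -/
lemma IsPoissonProcess.lintegral_prod_exp_neg_pointCount (hX : IsPoissonProcess P lam X)
    (hlam : 0 ≤ lam) {α : Type*} [MeasurableSpace α] [MeasurableSingletonClass α]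
    {g : Plane → α} (hg : Measurable g) (s : Finset α)
    (hs : ∀ v ∈ s, volume (g ⁻¹' {v}) < ∞) (c : α → ℝ) :
    ∫⁻ ω, ∏ v ∈ s, ENNReal.ofReal
        (Real.exp (-(c v * (pointCount X (g ⁻¹' {v}) ω).toReal))) ∂P =
      ∏ v ∈ s, ENNReal.ofReal
        (Real.exp (-(lam * (volume (g ⁻¹' {v})).toReal * (1 - Real.exp (-c v))))) := by
  classical
  let e := s.equivFin
  -- Independence is available for sequences of disjoint sets: the finitely many level sets are
  -- numbered by `e`, and all later indices get the empty set.
  let B : ℕ → Set Plane := fun j => ⋃ v : s, {x | (e v : ℕ) = j ∧ g x = v}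
  have hBe : ∀ v : s, B (e v) = g ⁻¹' {(v : α)} := fun v => by
    ext x
    simp only [B, mem_iUnion, mem_ofPred_eq, mem_preimage, mem_singleton_iff]
    constructor
    · rintro ⟨w, hw, hx⟩
      rw [hx, e.injective (Fin.ext hw)]
    · exact fun h => ⟨v, rfl, h⟩
  have hBm : ∀ j, MeasurableSet (B j) := fun j => by
    refine MeasurableSet.iUnion fun v => ?_
    by_cases h : (e v : ℕ) = j
    · simp only [h, true_and]
      exact hg (measurableSet_singleton (v : α))
    · simp [h]
  have hBf : ∀ j, volume (B j) < ∞ := fun j => by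
    by_cases h : ∃ v : s, (e v : ℕ) = j
    · obtain ⟨v, rfl⟩ := h
      rw [hBe]
      exact hs v v.2
    · have : B j = ∅ := by
        push Not at h
        simp [B, h]
      simp [this]
  have hBd : Pairwise fun j k => Disjoint (B j) (B k) := fun j k hjk => by
    simp only [Set.disjoint_left]
    simp only [B, mem_iUnion, mem_ofPred_eq, not_exists]
    rintro x ⟨v, hv, hxv⟩ w ⟨hw, hxw⟩
    exact hjk (by rw [← hv, ← hw, Subtype.ext (hxv.symm.trans hxw)])
  have hind := (hX.count_indep B hBm hBf hBd).precomp
    (g := fun v : s => ((e v : ℕ))) (fun v w h => e.injective (Fin.ext h))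
  simp only [hBe] at hind
  have hind2 := hind.comp (fun (v : s) x => ENNReal.ofReal (Real.exp (-(c v * x.toReal))))
    (fun v => by fun_prop)
  have hcm : ∀ v : s, Measurable (pointCount X (g ⁻¹' {(v : α)})) := fun v =>
    hX.measurable_pointCount (hg (measurableSet_singleton _))
  have := lintegral_prod_eq_prod_lintegral_of_indepFun Finset.univ _ hind2
    (fun v => (show Measurable fun x : ℝ≥0∞ =>
      ENNReal.ofReal (Real.exp (-(c v * x.toReal))) by fun_prop).comp (hcm v))
  simp only [Function.comp_apply] at this
  rw [Finset.univ_eq_attach, Finset.prod_attach s (fun v => ∫⁻ ω, ENNReal.ofReal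
        (Real.exp (-(c v * (pointCount X (g ⁻¹' {v}) ω).toReal))) ∂P)] at this
  rw [← Finset.prod_congr rfl fun v hv => hX.lintegral_exp_neg_pointCount hlam
    (hg (measurableSet_singleton v)) (hs v hv) (c v), ← this]
  congr with ω
  exact (Finset.prod_attach s (fun v => ENNReal.ofReal
        (Real.exp (-(c v * (pointCount X (g ⁻¹' {v}) ω).toReal))))).symm

end Counts

/-! ### The marked process -/

section Marked

/-- The level set of `0` may have infinite volume; `f 0 = 0` allows it to be left out. -/
lemma apply_simpleFunc_eq_sum {M : Type*} [AddCommMonoid M] (g : SimpleFunc Plane ℝ≥0) (f : ℝ≥0 → M)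
    (hf : f 0 = 0) (x : Plane) :
    f (g x) = ∑ v ∈ g.range.erase 0, (g ⁻¹' {v}).indicator (fun _ => f v) x := by
  classical
  simp only [indicator_apply, mem_preimage, mem_singleton_iff]
  rw [Finset.sum_ite_eq]
  split_ifs with h
  · rfl
  · rw [Finset.mem_erase, not_and'] at h
    have h0 := h (SimpleFunc.mem_range_self g x)
    rw [not_not] at h0
    rw [h0, hf]

variable {Ω : Type*} [MeasurableSpace Ω] {P : Measure Ω} {lam : ℝ} {H : Measure ℝ}
  {X : ℕ → Ω → Plane} {h : ℕ → Ω → ℝ}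

/-- The positions and the fading powers have a product law. -/
lemma IsCellularNetwork.lintegral_joint (hN : IsCellularNetwork P lam H X h)
    {F : (ℕ → Plane) → (ℕ → ℝ) → ℝ≥0∞} (hF : Measurable (Function.uncurry F)) :
    ∫⁻ ω, F (fun i => X i ω) (fun i => h i ω) ∂P =
      ∫⁻ ω, ∫⁻ ω', F (fun i => X i ω) (fun i => h i ω') ∂P ∂P := by
  have := hN.isProbabilityMeasure
  have hXm : Measurable fun ω i => X i ω := measurable_pi_lambda _ hN.poisson.measurable
  have hhm : Measurable fun ω i => h i ω := measurable_pi_lambda _ hN.fading_measurable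
  have hlaw := (indepFun_iff_map_prod_eq_prod_map_map hXm.aemeasurable hhm.aemeasurable).1 hN.indep
  calc ∫⁻ ω, F (fun i => X i ω) (fun i => h i ω) ∂P
      = ∫⁻ p, Function.uncurry F p ∂(P.map fun ω => (fun i => X i ω, fun i => h i ω)) :=
        (lintegral_map hF (hXm.prodMk hhm)).symm
    _ = ∫⁻ ξ, ∫⁻ η, F ξ η ∂(P.map fun ω i => h i ω) ∂(P.map fun ω i => X i ω) := by
        have := Measure.isProbabilityMeasure_map (μ := P) hhm.aemeasurable
        rw [hlaw, lintegral_prod _ hF.aemeasurable]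
        rfl
    _ = _ := by
        have := Measure.isProbabilityMeasure_map (μ := P) hhm.aemeasurable
        rw [lintegral_map (f := fun ξ => ∫⁻ η, F ξ η ∂(P.map fun ω i => h i ω))
          (Measurable.lintegral_prod_right' hF) hXm]
        refine lintegral_congr fun ω => ?_
        exact lintegral_map (hF.comp (measurable_const.prodMk measurable_id)) hhm

lemma IsCellularNetwork.lintegral_comp_fading (hN : IsCellularNetwork P lam H X h) (i : ℕ)
    {f : ℝ → ℝ≥0∞} (hf : Measurable f) : ∫⁻ ω, f (h i ω) ∂P = ∫⁻ y, f y ∂H := by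
  rw [← hN.fading_law i, lintegral_map hf (hN.fading_measurable i)]

lemma IsCellularNetwork.ae_fading_nonneg (hN : IsCellularNetwork P lam H X h)
    (hH : UnitMeanFading H) : ∀ᵐ ω ∂P, ∀ i, 0 ≤ h i ω := by
  rw [ae_all_iff]
  intro i
  have := hH.nonneg
  rw [← hN.fading_law i] at this
  exact ae_of_ae_map (hN.fading_measurable i).aemeasurable this

/-- With the positions frozen, the factors are independent and each fading power integrates out to
its Laplace transform. This removes the marks. -/
lemma IsCellularNetwork.lintegral_prod_exp (hN : IsCellularNetwork P lam H X h)
    (hH : UnitMeanFading H) {g : Plane → ℝ≥0} (hg : Measurable g) (n : ℕ) :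
    ∫⁻ ω, ∏ i ∈ Finset.range n, ENNReal.ofReal (Real.exp (-(g (X i ω) * h i ω))) ∂P =
      ∫⁻ ω, ∏ i ∈ Finset.range n, ENNReal.ofReal (fadingLaplace H (g (X i ω))) ∂P := by
  rw [hN.lintegral_joint (F := fun ξ η =>
    ∏ i ∈ Finset.range n, ENNReal.ofReal (Real.exp (-(g (ξ i) * η i))))]
  · refine lintegral_congr fun ω => ?_
    have hind := hN.fading_indep.comp
      (fun i y => ENNReal.ofReal (Real.exp (-(g (X i ω) * y)))) (fun i => by fun_prop)
    have := lintegral_prod_eq_prod_lintegral_of_indepFun (Finset.range n) _ hind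
      (fun i => (show Measurable fun y : ℝ =>
        ENNReal.ofReal (Real.exp (-(g (X i ω) * y))) by fun_prop).comp (hN.fading_measurable i))
    simp only [Function.comp_apply] at this
    rw [this]
    refine Finset.prod_congr rfl fun i _ => ?_
    rw [hN.lintegral_comp_fading i (f := fun y => ENNReal.ofReal (Real.exp (-(g (X i ω) * y))))
      (by fun_prop), hH.lintegral_ofReal_exp (g (X i ω)).coe_nonneg]
  · refine Finset.measurable_fun_prod _ fun i _ => ?_
    have : Measurable fun p : (ℕ → Plane) × (ℕ → ℝ) => g (p.1 i) :=
      hg.comp ((measurable_pi_apply i).comp measurable_fst)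
    fun_prop

/-- The limit of the partial exponential functionals at a simple function of finite support. -/
lemma IsPoissonProcess.tendsto_lintegral_prod [IsProbabilityMeasure P]
    (hX : IsPoissonProcess P lam X) (hlam : 0 ≤ lam)
    (hH : UnitMeanFading H) (g : SimpleFunc Plane ℝ≥0) (hg : volume {x | g x ≠ 0} < ∞) :
    Tendsto (fun n => ∫⁻ ω, ∏ i ∈ Finset.range n,
        ENNReal.ofReal (fadingLaplace H (g (X i ω))) ∂P) atTop
      (𝓝 (ENNReal.ofReal (Real.exp (-(lam * ∫ x, (1 - fadingLaplace H (g x))))))) := by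
  classical
  set s := g.range.erase 0 with hs
  have hvol : ∀ v ∈ s, volume (g ⁻¹' {v}) < ∞ := fun v hv => by
    refine (measure_mono fun x hx => ?_).trans_lt hg
    rw [mem_preimage, mem_singleton_iff] at hx
    rw [mem_ofPred_eq, hx]
    exact (Finset.mem_erase.1 hv).1
  -- With this `c` the product of Laplace transforms is `exp (-∑ c (g (X i)))`, an exponential
  -- functional of the unmarked process, hence of the counts on the level sets of `g`.
  set c : ℝ≥0 → ℝ := fun v => -Real.log (fadingLaplace H v) with hc
  have hexp : ∀ v : ℝ≥0, Real.exp (-c v) = fadingLaplace H v := fun v => by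
    rw [hc, neg_neg, Real.exp_log (hH.fadingLaplace_pos v.coe_nonneg)]
  have hc0 : ∀ v, 0 ≤ c v := fun v => by
    have := Real.log_nonpos (hH.fadingLaplace_pos v.coe_nonneg).le
      (hH.fadingLaplace_le_one v.coe_nonneg)
    simp only [hc]; linarith
  have hcz : c 0 = 0 := by simp [hc, hH.fadingLaplace_zero]
  -- the value of the limit
  have hlim : ENNReal.ofReal (Real.exp (-(lam * ∫ x, (1 - fadingLaplace H (g x))))) =
      ∫⁻ ω, ∏ v ∈ s, ENNReal.ofReal
        (Real.exp (-(c v * (pointCount X (g ⁻¹' {v}) ω).toReal))) ∂P := by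
    rw [hX.lintegral_prod_exp_neg_pointCount hlam g.measurable s hvol c,
      ← ENNReal.ofReal_prod_of_nonneg fun _ _ => (Real.exp_pos _).le, ← Real.exp_sum,
      Finset.sum_neg_distrib]
    have h1 : ∀ x, 1 - fadingLaplace H (g x) =
        ∑ v ∈ s, (g ⁻¹' {v}).indicator (fun _ => 1 - fadingLaplace H v) x := fun x =>
      apply_simpleFunc_eq_sum g (fun v : ℝ≥0 => 1 - fadingLaplace H v)
        (by simp [hH.fadingLaplace_zero]) x
    simp_rw [h1, hexp]
    rw [integral_finsetSum _ fun v hv => (integrable_indicator_iff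
      (g.measurableSet_preimage _)).2 (integrableOn_const (hvol v hv).ne), Finset.mul_sum]
    congr 4 with v
    rw [integral_indicator_const _ (g.measurableSet_preimage _), smul_eq_mul, ← mul_assoc]
    rfl
  rw [hlim]
  -- The products are at most `1`. They converge almost surely because the support of `g` then
  -- contains finitely many points, so the exponents have a finite sum.
  refine tendsto_lintegral_of_dominated_convergence (fun _ => 1) (fun n => ?_) (fun n => ?_)
    (by simp) ?_
  · refine Finset.measurable_fun_prod _ fun i _ => ?_
    exact (hH.measurable_fadingLaplace.comp (measurable_coe_nnreal_real.comp
      (g.measurable.comp (hX.measurable i)))).ennreal_ofReal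
  · refine ae_of_all _ fun ω => Finset.prod_le_one' fun i _ => ?_
    exact ENNReal.ofReal_le_one.2 (hH.fadingLaplace_le_one (NNReal.coe_nonneg _))
  · have hfin : ∀ᵐ ω ∂P, ∀ v ∈ s, pointCount X (g ⁻¹' {v}) ω < ∞ :=
      (ae_ball_iff s.countable_toSet).2 fun v hv =>
        hX.ae_pointCount_lt_top (g.measurableSet_preimage _) (hvol v hv)
    filter_upwards [hfin] with ω hω
    have htsum : ∑' i, ENNReal.ofReal (c (g (X i ω))) =
        ∑ v ∈ s, ENNReal.ofReal (c v) * pointCount X (g ⁻¹' {v}) ω := by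
      unfold pointCount
      simp_rw [← ENNReal.tsum_mul_left]
      rw [← Summable.tsum_finsetSum fun _ _ => ENNReal.summable]
      congr with i
      rw [apply_simpleFunc_eq_sum g (fun v : ℝ≥0 => ENNReal.ofReal (c v)) (by simp [hcz])]
      refine Finset.sum_congr rfl fun v _ => ?_
      by_cases hx : X i ω ∈ g ⁻¹' {v} <;> simp [hx]
    have hne : ∑' i, ENNReal.ofReal (c (g (X i ω))) ≠ ∞ := by
      rw [htsum]
      exact (ENNReal.sum_lt_top.2 fun v hv =>
        ENNReal.mul_lt_top ENNReal.ofReal_lt_top (hω v hv)).ne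
    have ht := (ENNReal.tendsto_toReal hne).comp (ENNReal.tendsto_nat_tsum
      fun i => ENNReal.ofReal (c (g (X i ω))))
    have ht2 := (ENNReal.continuous_ofReal.tendsto _).comp
      ((Real.continuous_exp.tendsto _).comp ht.neg)
    convert ht2 using 1
    · ext n
      simp only [Function.comp_apply]
      rw [ENNReal.toReal_sum fun _ _ => ENNReal.ofReal_ne_top, ← Finset.sum_neg_distrib,
        Real.exp_sum, ENNReal.ofReal_prod_of_nonneg fun _ _ => (Real.exp_pos _).le]
      refine Finset.prod_congr rfl fun i _ => ?_
      rw [ENNReal.toReal_ofReal (hc0 _), hexp]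
    · rw [htsum, ENNReal.toReal_sum fun v hv =>
        (ENNReal.mul_lt_top ENNReal.ofReal_lt_top (hω v hv)).ne, ← Finset.sum_neg_distrib,
        Real.exp_sum, ENNReal.ofReal_prod_of_nonneg fun _ _ => (Real.exp_pos _).le]
      congr 1
      refine Finset.prod_congr rfl fun v _ => ?_
      rw [ENNReal.toReal_mul, ENNReal.toReal_ofReal (hc0 _)]

/-- Chernoff's bound for the lower tail of the total power under a simple path loss. -/
lemma IsCellularNetwork.measure_tsum_le (hN : IsCellularNetwork P lam H X h)
    (hH : UnitMeanFading H) (hlam : 0 ≤ lam) (g : SimpleFunc Plane ℝ≥0) (hg : volume {x | g x ≠ 0} < ∞)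
    {a : ℝ} (ha : 0 ≤ a) :
    P {ω | ∑' i, ENNReal.ofReal (h i ω) * g (X i ω) ≤ ENNReal.ofReal a} ≤
      ENNReal.ofReal (Real.exp (a - lam * ∫ x, (1 - fadingLaplace H (g x)))) := by
  have := hN.isProbabilityMeasure
  have hlim := ENNReal.Tendsto.const_mul (a := ENNReal.ofReal (Real.exp a))
    (hN.poisson.tendsto_lintegral_prod hlam hH g hg) (Or.inr ENNReal.ofReal_ne_top)
  rw [← ENNReal.ofReal_mul (Real.exp_pos _).le, ← Real.exp_add, ← sub_eq_add_neg] at hlim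
  -- Partial sums are below the total, so Markov's inequality applied to each partial product bounds
  -- the same event.
  refine ge_of_tendsto' hlim fun n => ?_
  rw [← hN.lintegral_prod_exp hH g.measurable n]
  have hmeas : Measurable fun ω =>
      ∏ i ∈ Finset.range n, ENNReal.ofReal (Real.exp (-(g (X i ω) * h i ω))) := by
    refine Finset.measurable_fun_prod _ fun i _ => ?_
    have h1 : Measurable fun ω => g (X i ω) := g.measurable.comp (hN.poisson.measurable i)
    exact (Real.measurable_exp.comp
      ((measurable_coe_nnreal_real.comp h1).mul (hN.fading_measurable i)).neg).ennreal_ofReal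
  rw [← lintegral_const_mul _ hmeas]
  refine (measure_mono_ae ?_).trans ((meas_ge_le_lintegral_div (ε := 1)
    (hmeas.const_mul (ENNReal.ofReal (Real.exp a))).aemeasurable one_ne_zero
    ENNReal.one_ne_top).trans (by rw [div_one]))
  filter_upwards [hN.ae_fading_nonneg hH] with ω hω hle
  change ∑' i, ENNReal.ofReal (h i ω) * g (X i ω) ≤ ENNReal.ofReal a at hle
  change 1 ≤ ENNReal.ofReal (Real.exp a) *
    ∏ i ∈ Finset.range n, ENNReal.ofReal (Real.exp (-(g (X i ω) * h i ω)))
  have hpart := (ENNReal.sum_le_tsum (Finset.range n)).trans hle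
  have heq : ∀ i, ENNReal.ofReal (h i ω) * g (X i ω) = ENNReal.ofReal (g (X i ω) * h i ω) :=
    fun i => by
      rw [mul_comm, ENNReal.ofReal_mul (NNReal.coe_nonneg _), ENNReal.ofReal_coe_nnreal]
  simp_rw [heq] at hpart
  rw [← ENNReal.ofReal_sum_of_nonneg fun i _ => mul_nonneg (NNReal.coe_nonneg _) (hω i),
    ENNReal.ofReal_le_ofReal_iff ha] at hpart
  rw [← ENNReal.ofReal_prod_of_nonneg fun _ _ => (Real.exp_pos _).le, ← Real.exp_sum,
    ← ENNReal.ofReal_mul (Real.exp_pos _).le, ← Real.exp_add, Finset.sum_neg_distrib,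
    ENNReal.one_le_ofReal]
  exact Real.one_le_exp (by linarith)

end Marked

/-! ### The serving base station -/

section Serving

variable {Ω : Type*} {X : ℕ → Ω → Plane} {h : ℕ → Ω → ℝ}

/-- A finite nonempty set of points in the disc has a closest one, which is then closest overall.
Without finiteness the minimum may not be attained, and `servingIndex` would be the default `0`. -/
lemma servingDist_le {ω : Ω} {s : ℝ} (h0 : pointCount X (Metric.closedBall 0 s) ω ≠ 0)
    (hfin : pointCount X (Metric.closedBall 0 s) ω ≠ ∞) : servingDist X ω ≤ s := by
  have hmem : ∀ i, X i ω ∈ Metric.closedBall (0 : Plane) s ↔ ‖X i ω‖ ≤ s := fun i => by simp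
  have hS : {i | ‖X i ω‖ ≤ s}.Finite := by
    refine (ENNReal.finite_const_le_of_tsum_ne_top hfin one_ne_zero).subset fun i hi => ?_
    rw [mem_ofPred_eq, ← hmem] at hi
    simp [indicator_of_mem hi]
  have hne : {i | ‖X i ω‖ ≤ s}.Nonempty := by
    by_contra hcon
    rw [not_nonempty_iff_eq_empty] at hcon
    refine h0 (ENNReal.tsum_eq_zero.2 fun i => indicator_of_notMem (fun hi => ?_) _)
    have : i ∈ {i | ‖X i ω‖ ≤ s} := (hmem i).1 hi
    simp [hcon] at this
  obtain ⟨i, hi, hmin⟩ := Set.exists_min_image _ (fun i => ‖X i ω‖) hS hne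
  have hglob : ∀ j, ‖X i ω‖ ≤ ‖X j ω‖ := fun j => by
    by_cases hj : ‖X j ω‖ ≤ s
    · exact hmin j hj
    · exact (show ‖X i ω‖ ≤ s from hi).trans (not_le.1 hj).le
  have hserv : servingIndex X ω ∈ {i | ∀ j, ‖X i ω‖ ≤ ‖X j ω‖} := Nat.sInf_mem ⟨i, hglob⟩
  exact (hserv i).trans hi

/-- The disc of radius `s` around the origin holds no point, or infinitely many. -/
def discBad (X : ℕ → Ω → Plane) (s : ℝ) : Set Ω :=
  {ω | pointCount X (Metric.closedBall 0 s) ω = 0} ∪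
    {ω | pointCount X (Metric.closedBall 0 s) ω = ∞}

lemma servingDist_le_of_notMem {ω : Ω} {s : ℝ} (hω : ω ∉ discBad X s) : servingDist X ω ≤ s :=
  servingDist_le (fun h0 => hω (Or.inl h0)) (fun h0 => hω (Or.inr h0))

/-- Points outside a disc that holds the serving base station interfere. -/
lemma tsum_le_interference {L : ℝ → ℝ} (hL : PhysicallyFeasible L) {ω : Ω} {s : ℝ}
    (hs : servingDist X ω ≤ s) {g : Plane → ℝ≥0∞}
    (hg : ∀ x, g x ≤ ENNReal.ofReal (L ‖x‖)) (hg0 : ∀ x, ‖x‖ ≤ s → g x = 0) :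
    ∑' i, ENNReal.ofReal (h i ω) * g (X i ω) ≤ interference L X h ω := by
  refine ENNReal.tsum_le_tsum fun i => ?_
  by_cases hi : ‖X i ω‖ ≤ s
  · simp [hg0 _ hi]
  · rw [indicator_of_mem (show i ∈ {i | servingDist X ω < ‖X i ω‖} from hs.trans_lt (not_le.1 hi)),
      ENNReal.ofReal_mul' (hL.nonneg _ (norm_nonneg _))]
    gcongr
    exact hg _

lemma interference_le_tsum {L : ℝ → ℝ} (hL : PhysicallyFeasible L) (ω : Ω) :
    interference L X h ω ≤ ∑' i, ENNReal.ofReal (h i ω) * ENNReal.ofReal (L ‖X i ω‖) := by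
  refine ENNReal.tsum_le_tsum fun i => ?_
  rw [← ENNReal.ofReal_mul' (hL.nonneg _ (norm_nonneg _))]
  exact indicator_le_self _ (fun i => ENNReal.ofReal (h i ω * L ‖X i ω‖)) i

variable [MeasurableSpace Ω] {P : Measure Ω} {lam : ℝ}

lemma volume_closedBall_lt_top (s : ℝ) : volume (Metric.closedBall (0 : Plane) s) < ∞ :=
  measure_closedBall_lt_top

lemma volume_closedBall_toReal {s : ℝ} (hs : 0 ≤ s) :
    (volume (Metric.closedBall (0 : Plane) s)).toReal = Real.pi * s ^ 2 := by
  rw [EuclideanSpace.volume_closedBall_fin_two, ENNReal.toReal_mul, ENNReal.toReal_pow,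
    ENNReal.toReal_ofReal hs, ENNReal.toReal_ofReal Real.pi_pos.le, mul_comm]

lemma IsPoissonProcess.measurableSet_discBad (hX : IsPoissonProcess P lam X) (s : ℝ) :
    MeasurableSet (discBad X s) :=
  (hX.measurable_pointCount measurableSet_closedBall (measurableSet_singleton _)).union
    (hX.measurable_pointCount measurableSet_closedBall (measurableSet_singleton _))

lemma IsPoissonProcess.measure_discBad_le (hX : IsPoissonProcess P lam X) (hlam : 0 ≤ lam) {s : ℝ}
    (hs : 0 ≤ s) :
    P (discBad X s) ≤ ENNReal.ofReal (Real.exp (-(lam * (Real.pi * s ^ 2)))) := by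
  have h1 := hX.measure_pointCount_eq_zero hlam measurableSet_closedBall
    (volume_closedBall_lt_top s)
  rw [volume_closedBall_toReal hs] at h1
  have h2 : P {ω | pointCount X (Metric.closedBall 0 s) ω = ∞} = 0 := by
    have := hX.ae_pointCount_lt_top measurableSet_closedBall (volume_closedBall_lt_top s)
    rw [ae_iff] at this
    simpa only [not_lt_top_iff] using this
  refine (measure_union_le _ _).trans ?_
  rw [h1, h2, add_zero]

end Serving

/-! ### Negative moments of the interference -/

section NegativeMoments

variable {L : ℝ → ℝ} {H : Measure ℝ}

/-- Under the simple conditions the path loss decays at most like a Gaussian. -/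
lemma SimpleConditions.exists_gaussian_le (hcond : SimpleConditions L)
    (hL : PhysicallyFeasible L) :
    ∃ r₁ : ℝ, 1 ≤ r₁ ∧ AntitoneOn L (Ici r₁) ∧ ∃ c : ℝ, 0 < c ∧ ∃ K : ℝ, 0 < K ∧
      ∀ r, r₁ ≤ r → c * Real.exp (-(K * r ^ 2)) ≤ L r := by
  obtain ⟨r₀, hr₀, ζ, -, hanti, -, -, lamc, hlamc, hfin⟩ := hcond
  set l := lamc + 1
  have hA := hfin l (by simp [l])
  set A := ∫⁻ r in Ioi r₀,
    ENNReal.ofReal (r * Real.exp (-Real.pi * l * r ^ 2)) / ENNReal.ofReal (L r) ^ 2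
  set A' := A.toReal + 1
  have hA'pos : 0 < A' := by positivity
  have hAA' : A ≤ ENNReal.ofReal A' := by
    rw [← ENNReal.ofReal_toReal hA.ne]
    exact ENNReal.ofReal_le_ofReal (by simp [A'])
  have hpl : 0 < Real.pi * l := mul_pos Real.pi_pos (by simp only [l]; linarith)
  refine ⟨max r₀ 1, le_max_right _ _, hanti.mono (Ici_subset_Ici.2 (le_max_left _ _)),
    (√A')⁻¹, by positivity, 2 * (Real.pi * l), by positivity, fun r hr => ?_⟩
  have hr0 : r₀ ≤ r := (le_max_left _ _).trans hr
  have hr1 : 1 ≤ r := (le_max_right _ _).trans hr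
  have hLr : 0 ≤ L r := hL.nonneg r (by linarith)
  -- On `(r, r + 1]` one has `L s ≤ L r` and, as `r ≥ 1`, `s ≤ 2 r`. So the left side is below the
  -- integrand on an interval of length one. Taking a square root gives the Gaussian bound.
  have hk : ENNReal.ofReal (Real.exp (-(4 * (Real.pi * l) * r ^ 2))) / ENNReal.ofReal (L r) ^ 2 ≤
      ENNReal.ofReal A' := by
    refine le_trans ?_ hAA'
    calc ENNReal.ofReal (Real.exp (-(4 * (Real.pi * l) * r ^ 2))) / ENNReal.ofReal (L r) ^ 2
        = ∫⁻ _ in Ioc r (r + 1), ENNReal.ofReal (Real.exp (-(4 * (Real.pi * l) * r ^ 2))) /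
            ENNReal.ofReal (L r) ^ 2 := by simp
      _ ≤ ∫⁻ s in Ioc r (r + 1), ENNReal.ofReal (s * Real.exp (-Real.pi * l * s ^ 2)) /
            ENNReal.ofReal (L s) ^ 2 := by
          refine setLIntegral_mono' measurableSet_Ioc fun s hs => ?_
          have hLs : L s ≤ L r := hanti hr0 (hr0.trans hs.1.le) hs.1.le
          gcongr
          have hs2 : s ^ 2 ≤ 4 * r ^ 2 := by nlinarith [hs.1, hs.2]
          have : Real.exp (-(4 * (Real.pi * l) * r ^ 2)) ≤ Real.exp (-Real.pi * l * s ^ 2) :=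
            Real.exp_le_exp.2 (by nlinarith)
          have h1 : 1 ≤ s := hr1.trans hs.1.le
          nlinarith [Real.exp_pos (-Real.pi * l * s ^ 2)]
      _ ≤ A := lintegral_mono_set fun s hs => hr0.trans_lt hs.1
  rw [ENNReal.div_le_iff_le_mul (Or.inr ENNReal.ofReal_ne_top) (Or.inr (by simpa using hA'pos)),
    ← ENNReal.ofReal_pow hLr, ← ENNReal.ofReal_mul hA'pos.le,
    ENNReal.ofReal_le_ofReal_iff (by positivity)] at hk
  have hsq : Real.exp (-(2 * (Real.pi * l) * r ^ 2)) ^ 2 ≤ (√A' * L r) ^ 2 := by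
    rw [← Real.exp_nat_mul, mul_pow, Real.sq_sqrt hA'pos.le]
    refine le_trans (le_of_eq ?_) hk
    congr 1
    push_cast
    ring
  rw [pow_le_pow_iff_left₀ (Real.exp_pos _).le (by positivity) two_ne_zero] at hsq
  rwa [inv_mul_le_iff₀ (by positivity)]

variable {Ω : Type*} {X : ℕ → Ω → Plane} {h : ℕ → Ω → ℝ}

/-- The annulus `{s < |x| ≤ 2 s}`. -/
def annulus (s : ℝ) : Set Plane := Metric.closedBall 0 (2 * s) \ Metric.closedBall 0 s

lemma measurableSet_annulus (s : ℝ) : MeasurableSet (annulus s) :=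
  measurableSet_closedBall.diff measurableSet_closedBall

lemma volume_annulus_lt_top (s : ℝ) : volume (annulus s) < ∞ :=
  (measure_mono sdiff_subset).trans_lt (volume_closedBall_lt_top _)

lemma volume_annulus_toReal {s : ℝ} (hs : 0 ≤ s) :
    (volume (annulus s)).toReal = 3 * (Real.pi * s ^ 2) := by
  rw [annulus, measure_sdiff (Metric.closedBall_subset_closedBall (by linarith))
    measurableSet_closedBall.nullMeasurableSet (volume_closedBall_lt_top _).ne,
    ENNReal.toReal_sub_of_le (measure_mono (Metric.closedBall_subset_closedBall (by linarith)))
    (volume_closedBall_lt_top _).ne, volume_closedBall_toReal hs,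
    volume_closedBall_toReal (by linarith)]
  ring

/-- The sum of the fading powers over the annulus. -/
def annulusPower (X : ℕ → Ω → Plane) (h : ℕ → Ω → ℝ) (s : ℝ) (ω : Ω) : ℝ≥0∞ :=
  ∑' i, ENNReal.ofReal (h i ω) * (annulus s).indicator 1 (X i ω)

/-- The serving base station may be far, or the annulus may hold little power. -/
def levelBad (X : ℕ → Ω → Plane) (h : ℕ → Ω → ℝ) (s : ℝ) : Set Ω :=
  discBad X s ∪ {ω | annulusPower X h s ω ≤ 1}

/-- The server lies within distance `s`, so every point of the annulus interferes, with path loss at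
least `L (2 * s)`; their total fading power exceeds `1`. -/
lemma ofReal_le_interference_of_notMem_levelBad (hL : PhysicallyFeasible L) {s : ℝ}
    (hanti : AntitoneOn L (Ici s)) {ω : Ω} (hω : ω ∉ levelBad X h s) :
    ENNReal.ofReal (L (2 * s)) ≤ interference L X h ω := by
  rw [levelBad, mem_union, not_or] at hω
  have hpow : 1 ≤ annulusPower X h s ω := (not_le.1 hω.2).le
  refine le_trans ?_ (tsum_le_interference hL (servingDist_le_of_notMem hω.1)
    (g := fun x => ENNReal.ofReal (L (2 * s)) * (annulus s).indicator 1 x) (fun x => ?_)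
    (fun x hx => ?_))
  · calc ENNReal.ofReal (L (2 * s)) ≤ ENNReal.ofReal (L (2 * s)) * annulusPower X h s ω :=
          le_mul_of_one_le_right zero_le hpow
      _ = _ := by
          rw [annulusPower, ← ENNReal.tsum_mul_left]
          congr with i
          ring
  · by_cases hx : x ∈ annulus s
    · simp only [hx, indicator_of_mem, Pi.one_apply, mul_one]
      simp only [annulus, Set.mem_sdiff, mem_closedBall_zero_iff, not_le] at hx
      exact ENNReal.ofReal_le_ofReal (hanti hx.2.le (hx.2.le.trans hx.1) hx.1)
    · simp [hx]
  · have : x ∉ annulus s := fun hx' => hx'.2 (by simpa using hx)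
    simp [this]

variable [MeasurableSpace Ω] {P : Measure Ω} {lam : ℝ}

lemma IsCellularNetwork.measurableSet_levelBad (hN : IsCellularNetwork P lam H X h) (s : ℝ) :
    MeasurableSet (levelBad X h s) := by
  refine (hN.poisson.measurableSet_discBad s).union (measurableSet_le ?_ measurable_const)
  exact Measurable.tsum fun i => (hN.fading_measurable i).ennreal_ofReal.mul
    ((measurable_one.indicator (measurableSet_annulus s)).comp (hN.poisson.measurable i))

/-- The void probability of the disc contributes one exponential, by `q ≤ 1`. Chernoff's bound for
the indicator of the annulus contributes a factor `e < 3`, whence the constant `4 = 1 + 3`. -/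
lemma IsCellularNetwork.measure_levelBad_le (hN : IsCellularNetwork P lam H X h)
    (hH : UnitMeanFading H) (hlam : 0 ≤ lam) {s : ℝ} (hs : 0 ≤ s) :
    P (levelBad X h s) ≤ ENNReal.ofReal
      (4 * Real.exp (-(lam * (1 - fadingLaplace H 1) * (Real.pi * s ^ 2)))) := by
  set q := 1 - fadingLaplace H 1 with hq
  have hq1 : q ≤ 1 := hH.one_sub_fadingLaplace_le zero_le_one
  have hq0 : 0 < q := sub_pos.2 hH.fadingLaplace_one_lt
  have hpow : P {ω | annulusPower X h s ω ≤ 1} ≤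
      ENNReal.ofReal (Real.exp (1 - lam * (3 * (Real.pi * s ^ 2) * q))) := by
    have hgeq : ∀ x, (SimpleFunc.const Plane (1 : ℝ≥0)).restrict (annulus s) x =
        (annulus s).indicator 1 x := fun x => by
      rw [SimpleFunc.restrict_apply _ (measurableSet_annulus s)]; rfl
    have hsupp : volume {x | (SimpleFunc.const Plane (1 : ℝ≥0)).restrict (annulus s) x ≠ 0} < ∞ := by
      refine (measure_mono fun x hx => ?_).trans_lt (volume_annulus_lt_top s)
      by_contra hcon
      rw [mem_ofPred_eq, hgeq] at hx
      exact hx (indicator_of_notMem hcon _)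
    have := hN.measure_tsum_le hH hlam _ hsupp zero_le_one
    have hint : ∫ x, (1 - fadingLaplace H ((SimpleFunc.const Plane (1 : ℝ≥0)).restrict
        (annulus s) x)) = 3 * (Real.pi * s ^ 2) * q := by
      have : ∀ x, (1 - fadingLaplace H ((SimpleFunc.const Plane (1 : ℝ≥0)).restrict
          (annulus s) x)) = (annulus s).indicator (fun _ => q) x := fun x => by
        rw [hgeq]
        by_cases hx : x ∈ annulus s <;> simp [hx, hq, hH.fadingLaplace_zero]
      simp_rw [this]
      rw [integral_indicator_const _ (measurableSet_annulus s), measureReal_def,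
        volume_annulus_toReal hs, smul_eq_mul]
    rw [hint] at this
    refine le_trans (le_of_eq ?_) this
    congr 1
    ext ω
    simp only [mem_ofPred_eq, ENNReal.ofReal_one, hgeq, annulusPower]
    have hcast : ∀ x, (((annulus s).indicator 1 x : ℝ≥0) : ℝ≥0∞) = (annulus s).indicator 1 x :=
      fun x => by by_cases hx : x ∈ annulus s <;> simp [hx]
    simp_rw [hcast]
  refine (measure_union_le _ _).trans ((add_le_add
    (hN.poisson.measure_discBad_le hlam hs) hpow).trans ?_)
  rw [← ENNReal.ofReal_add (Real.exp_pos _).le (Real.exp_pos _).le]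
  refine ENNReal.ofReal_le_ofReal ?_
  have hbase : 0 ≤ lam * (Real.pi * s ^ 2) := by positivity
  have h1 : Real.exp (-(lam * (Real.pi * s ^ 2))) ≤ Real.exp (-(lam * q * (Real.pi * s ^ 2))) :=
    Real.exp_le_exp.2 (by nlinarith)
  have h2 : Real.exp (1 - lam * (3 * (Real.pi * s ^ 2) * q)) ≤
      3 * Real.exp (-(lam * q * (Real.pi * s ^ 2))) := by
    rw [sub_eq_add_neg, Real.exp_add]
    have : Real.exp (-(lam * (3 * (Real.pi * s ^ 2) * q))) ≤
        Real.exp (-(lam * q * (Real.pi * s ^ 2))) :=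
      Real.exp_le_exp.2 (by nlinarith [mul_nonneg hbase hq0.le])
    have h3 := Real.exp_one_lt_three
    have := Real.exp_pos (-(lam * (3 * (Real.pi * s ^ 2) * q)))
    nlinarith
  linarith

/-- The second negative moment is bounded, uniformly over all large intensities. -/
theorem exists_secondNegativeMoment_le (hL : PhysicallyFeasible L) (hcond : SimpleConditions L)
    (hH : UnitMeanFading H) :
    ∃ lam₂ : ℝ, 0 < lam₂ ∧ ∃ C : ℝ, 0 ≤ C ∧ ∀ lam : ℝ, lam₂ ≤ lam →
      ∀ (Ω : Type*) [MeasurableSpace Ω] (P : Measure Ω) (X : ℕ → Ω → Plane) (h : ℕ → Ω → ℝ),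
        IsCellularNetwork P lam H X h → secondNegativeMoment P L X h ≤ ENNReal.ofReal C := by
  obtain ⟨r₁, hr₁, hanti, c, hc, K, hK, hlow⟩ := hcond.exists_gaussian_le hL
  set q := 1 - fadingLaplace H 1 with hq
  have hq0 : 0 < q := sub_pos.2 hH.fadingLaplace_one_lt
  set s : ℕ → ℝ := fun n => 2 ^ n * r₁ with hs
  have hsr : ∀ n, r₁ ≤ s n := fun n =>
    le_mul_of_one_le_left (by linarith) (one_le_pow₀ one_le_two)
  have hspos : ∀ n, 0 ≤ s n := fun n => by linarith [hsr n]
  have hssucc : ∀ n, s (n + 1) = 2 * s n := fun n => by simp only [hs]; ring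
  have hsn : ∀ n : ℕ, (n : ℝ) ≤ s n ^ 2 := fun n => by
    have h1 : (n : ℝ) ≤ 2 ^ n := by exact_mod_cast Nat.lt_two_pow_self.le
    have h2 : (2 : ℝ) ^ n ≤ s n := le_mul_of_one_le_right (by positivity) hr₁
    nlinarith [hsr n]
  have hinv : ∀ r, r₁ ≤ r → (ENNReal.ofReal (L r) ^ 2)⁻¹ ≤
      ENNReal.ofReal (c⁻¹ ^ 2 * Real.exp (2 * K * r ^ 2)) := fun r hr => by
    have hpos : 0 < c * Real.exp (-(K * r ^ 2)) := by positivity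
    have h1 : ENNReal.ofReal (c * Real.exp (-(K * r ^ 2))) ^ 2 ≤ ENNReal.ofReal (L r) ^ 2 := by
      gcongr
      exact hlow r hr
    refine (ENNReal.inv_le_inv.2 h1).trans (le_of_eq ?_)
    rw [← ENNReal.ofReal_pow hpos.le, ← ENNReal.ofReal_inv_of_pos (by positivity), mul_pow,
      mul_inv, ← Real.exp_nat_mul, ← Real.exp_neg, inv_pow]
    congr 3
    push_cast
    ring
  have hsum : Summable fun n : ℕ => 4 * c⁻¹ ^ 2 * Real.exp (-(n : ℝ)) :=
    Real.summable_exp_neg_nat.mul_left _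
  -- Since `s (n + 2) = 4 * s n`, the factor `L (s (n + 2))⁻²` costs `exp (32 K (s n)²)`. The extra
  -- `1` leaves `exp (-(s n)²) ≤ exp (-n)`, which is summable.
  refine ⟨(32 * K + 1) / (q * Real.pi), by positivity,
    c⁻¹ ^ 2 * Real.exp (2 * K * s 1 ^ 2) + ∑' n : ℕ, 4 * c⁻¹ ^ 2 * Real.exp (-(n : ℝ)),
    add_nonneg (by positivity) (tsum_nonneg fun n => by positivity), ?_⟩
  intro lam hlam Ω _ P X h hN
  have := hN.isProbabilityMeasure
  have hlam0 : 0 < lam := lt_of_lt_of_le (by positivity) hlam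
  have hlam' : 32 * K + 1 ≤ lam * q * Real.pi := by
    rw [div_le_iff₀ (by positivity)] at hlam; linarith
  have hgood : ∀ n ω, ω ∉ levelBad X h (s n) →
      (interference L X h ω ^ 2)⁻¹ ≤ (ENNReal.ofReal (L (s (n + 1))) ^ 2)⁻¹ := fun n ω hω => by
    have := ofReal_le_interference_of_notMem_levelBad hL
      (hanti.mono (Ici_subset_Ici.2 (hsr n))) hω
    rw [← hssucc] at this
    gcongr
  -- Look at the first good level. If it is `0`, the first term suffices; if it is `m + 1`, level
  -- `m` is bad and its term suffices. If no level is good, the series diverges, its terms being at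
  -- least `L(0)⁻² > 0`.
  have hpt : ∀ ω, (interference L X h ω ^ 2)⁻¹ ≤ (ENNReal.ofReal (L (s 1)) ^ 2)⁻¹ +
      ∑' n, (levelBad X h (s n)).indicator
        (fun _ => (ENNReal.ofReal (L (s (n + 2))) ^ 2)⁻¹) ω := fun ω => by
    by_cases hall : ∀ n, ω ∈ levelBad X h (s n)
    · have htop : ∑' n, (levelBad X h (s n)).indicator
          (fun _ => (ENNReal.ofReal (L (s (n + 2))) ^ 2)⁻¹) ω = ∞ := by
        rw [← top_le_iff]
        have hle : ∑' _ : ℕ, (ENNReal.ofReal (L 0) ^ 2)⁻¹ ≤ ∑' n, (levelBad X h (s n)).indicator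
          (fun _ => (ENNReal.ofReal (L (s (n + 2))) ^ 2)⁻¹) ω := by
          refine ENNReal.tsum_le_tsum fun n => ?_
          rw [indicator_of_mem (hall n)]
          gcongr
          exact hL.le_zero _ (hspos _)
        rwa [ENNReal.tsum_const_eq_top_of_ne_zero (by simp)] at hle
      rw [htop]
      simp
    · push Not at hall
      classical
      have hfind := Nat.find_spec hall
      have hmin : ∀ m < Nat.find hall, ω ∈ levelBad X h (s m) := fun m hm => by
        simpa using Nat.find_min hall hm
      rcases hn : Nat.find hall with _ | m
      · rw [hn] at hfind
        exact (hgood 0 ω hfind).trans le_self_add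
      · rw [hn] at hfind
        refine (hgood _ ω hfind).trans (le_trans ?_ le_add_self)
        refine le_trans (le_of_eq ?_) (ENNReal.le_tsum m)
        rw [indicator_of_mem (hmin m (by omega))]
  unfold secondNegativeMoment
  refine (lintegral_mono hpt).trans ?_
  rw [lintegral_add_left measurable_const, lintegral_tsum fun n =>
    (measurable_const.indicator (hN.measurableSet_levelBad (s n))).aemeasurable, lintegral_const,
    measure_univ, mul_one, ENNReal.ofReal_add (by positivity) (tsum_nonneg fun n => by positivity),
    ENNReal.ofReal_tsum_of_nonneg (fun n => by positivity) hsum]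
  refine add_le_add (hinv _ (hsr 1)) (ENNReal.tsum_le_tsum fun n => ?_)
  rw [lintegral_indicator_const (hN.measurableSet_levelBad (s n))]
  refine (mul_le_mul' (hinv _ (hsr _)) (hN.measure_levelBad_le hH hlam0.le (hspos n))).trans ?_
  rw [← ENNReal.ofReal_mul (by positivity)]
  refine ENNReal.ofReal_le_ofReal ?_
  have hs2 : s (n + 2) ^ 2 = 16 * s n ^ 2 := by rw [hssucc, hssucc]; ring
  have hexp : Real.exp (2 * K * s (n + 2) ^ 2) * Real.exp (-(lam * q * (Real.pi * s n ^ 2))) ≤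
      Real.exp (-(n : ℝ)) := by
    rw [← Real.exp_add, hs2]
    refine Real.exp_le_exp.2 ?_
    nlinarith [mul_le_mul_of_nonneg_right hlam' (sq_nonneg (s n)), hsn n]
  calc c⁻¹ ^ 2 * Real.exp (2 * K * s (n + 2) ^ 2) *
        (4 * Real.exp (-(lam * q * (Real.pi * s n ^ 2))))
      = 4 * c⁻¹ ^ 2 * (Real.exp (2 * K * s (n + 2) ^ 2) *
          Real.exp (-(lam * q * (Real.pi * s n ^ 2)))) := by ring
    _ ≤ _ := by gcongr

end NegativeMoments

/-! ### The Laplace-type double integral -/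

section LaplaceIntegral

variable {L : ℝ → ℝ} {H : Measure ℝ}

lemma UnitMeanFading.integral_one_sub_exp (hH : UnitMeanFading H) {t l : ℝ} (ht : 0 ≤ t)
    (hl : 0 ≤ l) : ∫ y, (1 - Real.exp (-(y * t * l))) ∂H = 1 - fadingLaplace H (t * l) := by
  rw [hH.one_sub_fadingLaplace (by positivity)]
  congr with y
  ring_nf

lemma integrableOn_mul_one_sub_fadingLaplace (hL : PhysicallyFeasible L) (hH : UnitMeanFading H)
    {t : ℝ} (ht : 0 ≤ t) :
    IntegrableOn (fun x => x * (1 - fadingLaplace H (t * L x))) (Ioi 0) := by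
  refine Integrable.mono' (hL.integrable.const_mul t) ?_ ?_
  · have := hH.measurable_fadingLaplace.comp (hL.measurable.const_mul t)
    exact (measurable_id.mul (measurable_const.sub this)).aestronglyMeasurable
  · filter_upwards [ae_restrict_mem measurableSet_Ioi] with x hx
    have hx0 : 0 < x := hx
    have h0 := mul_nonneg ht (hL.nonneg x hx0.le)
    rw [Real.norm_of_nonneg
      (mul_nonneg hx0.le (sub_nonneg.2 (hH.fadingLaplace_le_one h0)))]
    nlinarith [hH.one_sub_fadingLaplace_le h0]

/-- By monotonicity `t * L x ≥ 1` on `[r₁, s]`, so the inner integral is at least `q` there;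
integrate `x * q` from `max r r₁` to `s`. If `s < max r r₁` the left side is not positive. -/
lemma le_integral_one_sub_exp (hL : PhysicallyFeasible L) (hH : UnitMeanFading H) {r₁ : ℝ}
    (hr₁ : 0 ≤ r₁) (hanti : AntitoneOn L (Ici r₁)) {r s t : ℝ} (hr : 0 < r) (ht : 0 < t)
    (hs : r₁ ≤ s) (hts : 1 ≤ t * L s) :
    (1 - fadingLaplace H 1) * (s ^ 2 - r ^ 2 - r₁ ^ 2) ≤
      2 * ∫ x in Ioi r, x * ∫ y, (1 - Real.exp (-(y * t * L x))) ∂H := by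
  set q := 1 - fadingLaplace H 1 with hq
  have hq0 : 0 < q := sub_pos.2 hH.fadingLaplace_one_lt
  have heq : ∫ x in Ioi r, x * ∫ y, (1 - Real.exp (-(y * t * L x))) ∂H =
      ∫ x in Ioi r, x * (1 - fadingLaplace H (t * L x)) :=
    setIntegral_congr_fun measurableSet_Ioi fun x hx => by
      have hx0 : 0 < x := hr.trans hx
      rw [hH.integral_one_sub_exp ht.le (hL.nonneg x hx0.le)]
  have hint : IntegrableOn (fun x => x * (1 - fadingLaplace H (t * L x))) (Ioi r) :=
    (integrableOn_mul_one_sub_fadingLaplace hL hH ht.le).mono_set (Ioi_subset_Ioi hr.le)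
  have hnn : ∀ x ∈ Ioi r, 0 ≤ x * (1 - fadingLaplace H (t * L x)) := fun x hx => by
    have hx0 : 0 < x := hr.trans hx
    exact mul_nonneg hx0.le (sub_nonneg.2 (hH.fadingLaplace_le_one
      (mul_nonneg ht.le (hL.nonneg x hx0.le))))
  rw [heq]
  set m := max r r₁
  have hm2 : m ^ 2 ≤ r ^ 2 + r₁ ^ 2 := by
    rcases max_cases r r₁ with ⟨h, -⟩ | ⟨h, -⟩ <;> simp only [m, h] <;> nlinarith
  have hm0 : 0 < m := hr.trans_le (le_max_left _ _)
  rcases lt_or_ge s m with hsm | hsm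
  · have h1 := setIntegral_nonneg (μ := volume) measurableSet_Ioi hnn
    have h2 : s ^ 2 ≤ m ^ 2 := by nlinarith
    nlinarith
  · have h1 : ∫ x in Ioc m s, x * q ≤ ∫ x in Ioc m s, x * (1 - fadingLaplace H (t * L x)) := by
      refine setIntegral_mono_on ?_ (hint.mono_set ?_) measurableSet_Ioc fun x hx => ?_
      · exact (Continuous.integrableOn_Icc (by fun_prop)).mono_set Ioc_subset_Icc_self
      · exact fun x hx => (le_max_left _ _).trans_lt hx.1
      · have hx1 : r₁ ≤ x := (le_max_right _ _).trans hx.1.le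
        have hLx : L s ≤ L x := hanti hx1 hs hx.2
        have := hH.fadingLaplace_anti zero_le_one (hts.trans (mul_le_mul_of_nonneg_left hLx ht.le))
        exact mul_le_mul_of_nonneg_left (by linarith) (hm0.trans hx.1).le
    have h2 : ∫ x in Ioc m s, x * (1 - fadingLaplace H (t * L x)) ≤
        ∫ x in Ioi r, x * (1 - fadingLaplace H (t * L x)) := by
      refine setIntegral_mono_set hint
        ((ae_restrict_iff' measurableSet_Ioi).2 (ae_of_all _ hnn)) ?_
      exact (show Ioc m s ⊆ Ioi r from fun x hx => (le_max_left _ _).trans_lt hx.1).eventuallyLE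
    have h3 : ∫ x in Ioc m s, x * q = (s ^ 2 - m ^ 2) / 2 * q := by
      rw [← intervalIntegral.integral_of_le hsm, intervalIntegral.integral_mul_const, integral_id]
    nlinarith

/-- The double integral is finite at all large intensities. -/
theorem exists_laplaceIntegral_lt_top (hL : PhysicallyFeasible L) (hcond : SimpleConditions L)
    (hH : UnitMeanFading H) :
    ∃ lamc : ℝ, 0 ≤ lamc ∧ ∀ lam₀ : ℝ, lamc ≤ lam₀ → laplaceIntegral L H lam₀ < ∞ := by
  obtain ⟨r₁, hr₁, hanti, c, hc, K, hK, hlow⟩ := hcond.exists_gaussian_le hL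
  set q := 1 - fadingLaplace H 1 with hq
  have hq0 : 0 < q := sub_pos.2 hH.fadingLaplace_one_lt
  have hq1 : 0 < 1 - q := by rw [hq]; linarith [hH.fadingLaplace_pos (v := 1) zero_le_one]
  -- Chosen so that the exponential decays like `(t c)⁻³`: against the factor `t` this leaves the
  -- integrable power `t⁻²`.
  refine ⟨3 * K / (Real.pi * q), by positivity, fun lam hlam => ?_⟩
  have hlam0 : 0 < lam := lt_of_lt_of_le (by positivity) hlam
  have hlam' : 3 * K ≤ Real.pi * lam * q := by
    rw [div_le_iff₀ (by positivity)] at hlam; linarith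
  have hpl : 0 < Real.pi * lam := by positivity
  set t₀ := Real.exp (K * r₁ ^ 2) / c with ht₀
  have ht₀pos : 0 < t₀ := by positivity
  -- The term `-q r²` in `le_integral_one_sub_exp` spends the share `q` of the Gaussian in `r`; the
  -- share `1 - q > 0` remains.
  set b := Real.pi * lam * (1 - q) with hb
  have hbpos : 0 < b := by positivity
  set w : ℝ → ℝ≥0∞ := fun r => ENNReal.ofReal (2 * Real.pi * lam * (r * Real.exp (-b * r ^ 2)))
    with hw
  have hwm : Measurable w := by fun_prop
  have hwfin : ∫⁻ r in Ioi (0 : ℝ), w r < ∞ := by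
    have := (((integrable_mul_exp_neg_mul_sq hbpos).const_mul
      (2 * Real.pi * lam)).integrableOn (s := Ioi 0)).lintegral_lt_top
    exact this
  have hsmall : ∀ t ∈ Ioc 0 t₀, ∀ r ∈ Ioi (0 : ℝ), ENNReal.ofReal (2 * Real.pi * lam * r * t *
      Real.exp (-Real.pi * lam * r ^ 2 - 2 * Real.pi * lam *
          ∫ x in Ioi r, x * ∫ y, (1 - Real.exp (-(y * t * L x))) ∂H)) ≤
      ENNReal.ofReal t₀ * w r := fun t ht r hr => by
    have hr0 : 0 < r := hr
    rw [hw, ← ENNReal.ofReal_mul ht₀pos.le]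
    refine ENNReal.ofReal_le_ofReal ?_
    have hnn : 0 ≤ ∫ x in Ioi r, x * ∫ y, (1 - Real.exp (-(y * t * L x))) ∂H :=
      setIntegral_nonneg measurableSet_Ioi fun x hx => by
        have hx0 : 0 < x := hr0.trans hx
        have hLx := hL.nonneg x hx0.le
        rw [hH.integral_one_sub_exp ht.1.le hLx]
        exact mul_nonneg hx0.le (sub_nonneg.2 (hH.fadingLaplace_le_one (mul_nonneg ht.1.le hLx)))
    have hexp : Real.exp (-Real.pi * lam * r ^ 2 - 2 * Real.pi * lam *
          ∫ x in Ioi r, x * ∫ y, (1 - Real.exp (-(y * t * L x))) ∂H) ≤ Real.exp (-b * r ^ 2) := by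
      refine Real.exp_le_exp.2 ?_
      have h1 : 0 ≤ Real.pi * lam * q * r ^ 2 := by positivity
      have h2 := mul_nonneg (mul_nonneg two_pos.le hpl.le) hnn
      simp only [hb]
      linarith
    calc _ ≤ 2 * Real.pi * lam * r * t₀ * Real.exp (-b * r ^ 2) := by
          gcongr
          exact ht.2
      _ = _ := by ring
  have hlarge : ∀ t ∈ Ioi t₀, ∀ r ∈ Ioi (0 : ℝ), ENNReal.ofReal (2 * Real.pi * lam * r * t *
      Real.exp (-Real.pi * lam * r ^ 2 - 2 * Real.pi * lam *
          ∫ x in Ioi r, x * ∫ y, (1 - Real.exp (-(y * t * L x))) ∂H)) ≤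
      ENNReal.ofReal (Real.exp (Real.pi * lam * q * r₁ ^ 2) * c⁻¹ ^ 3 * t ^ (-2 : ℝ)) * w r :=
    fun t ht r hr => by
    have hr0 : 0 < r := hr
    have ht0 : 0 < t := ht₀pos.trans ht
    have htc : Real.exp (K * r₁ ^ 2) ≤ t * c := by
      have : t₀ < t := ht
      rw [ht₀, div_lt_iff₀ hc] at this
      exact this.le
    have htcpos : 0 < t * c := by positivity
    have hlog : K * r₁ ^ 2 ≤ Real.log (t * c) := (Real.le_log_iff_exp_le htcpos).2 htc
    -- The radius at which the Gaussian lower bound equals `1 / t`; `t > t₀` puts it beyond `r₁`.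
    set s := √(Real.log (t * c) / K) with hs
    have hs2 : K * s ^ 2 = Real.log (t * c) := by
      rw [hs, Real.sq_sqrt (div_nonneg (le_trans (by positivity) hlog) hK.le)]
      field_simp
    have hsr : r₁ ≤ s := Real.le_sqrt_of_sq_le (by rw [le_div_iff₀ hK]; linarith)
    have hts : 1 ≤ t * L s := by
      have := mul_le_mul_of_nonneg_left (hlow s hsr) ht0.le
      refine le_trans (le_of_eq ?_) this
      rw [hs2, Real.exp_neg, Real.exp_log htcpos]
      field_simp
    have hJ := le_integral_one_sub_exp hL hH (by linarith) hanti hr0 ht0 hsr hts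
    rw [hw, ← ENNReal.ofReal_mul (by positivity)]
    refine ENNReal.ofReal_le_ofReal ?_
    have hexp : Real.exp (-Real.pi * lam * r ^ 2 - 2 * Real.pi * lam *
          ∫ x in Ioi r, x * ∫ y, (1 - Real.exp (-(y * t * L x))) ∂H) ≤
        Real.exp (Real.pi * lam * q * r₁ ^ 2) * Real.exp (-b * r ^ 2) *
          Real.exp (-(3 * Real.log (t * c))) := by
      rw [← Real.exp_add, ← Real.exp_add]
      refine Real.exp_le_exp.2 ?_
      have h1 := mul_le_mul_of_nonneg_left hJ hpl.le
      have h2 := mul_le_mul_of_nonneg_right hlam' (sq_nonneg s)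
      rw [← hs2]
      simp only [hb]
      nlinarith
    have hpow : Real.exp (-(3 * Real.log (t * c))) = c⁻¹ ^ 3 * (t ^ 3)⁻¹ := by
      rw [Real.exp_neg, show (3 : ℝ) = ((3 : ℕ) : ℝ) by norm_num, Real.exp_nat_mul,
        Real.exp_log htcpos, mul_pow, mul_inv, inv_pow, mul_comm]
    have ht2 : t ^ (-2 : ℝ) = t * (t ^ 3)⁻¹ := by
      rw [Real.rpow_neg ht0.le, Real.rpow_two]
      field_simp
    calc _ ≤ 2 * Real.pi * lam * r * t * (Real.exp (Real.pi * lam * q * r₁ ^ 2) *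
          Real.exp (-b * r ^ 2) * Real.exp (-(3 * Real.log (t * c)))) := by gcongr
      _ = _ := by rw [hpow, ht2]; ring
  unfold laplaceIntegral
  rw [← Ioc_union_Ioi_eq_Ioi ht₀pos.le]
  refine (lintegral_union_le _ _ _).trans_lt (ENNReal.add_lt_top.2 ⟨?_, ?_⟩)
  · calc _ ≤ ∫⁻ t in Ioc 0 t₀, ENNReal.ofReal t₀ * ∫⁻ r in Ioi (0 : ℝ), w r := by
          refine setLIntegral_mono' measurableSet_Ioc fun t ht => ?_
          rw [← lintegral_const_mul _ hwm, Ioc_union_Ioi_eq_Ioi ht₀pos.le]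
          exact setLIntegral_mono' measurableSet_Ioi (hsmall t ht)
      _ < ∞ := by
          rw [setLIntegral_const, Real.volume_Ioc]
          exact ENNReal.mul_lt_top (ENNReal.mul_lt_top ENNReal.ofReal_lt_top hwfin)
            ENNReal.ofReal_lt_top
  · calc _ ≤ ∫⁻ t in Ioi t₀, ENNReal.ofReal (Real.exp (Real.pi * lam * q * r₁ ^ 2) * c⁻¹ ^ 3 *
            t ^ (-2 : ℝ)) * ∫⁻ r in Ioi (0 : ℝ), w r := by
          refine setLIntegral_mono' measurableSet_Ioi fun t ht => ?_
          rw [← lintegral_const_mul _ hwm, Ioc_union_Ioi_eq_Ioi ht₀pos.le]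
          exact setLIntegral_mono' measurableSet_Ioi (hlarge t ht)
      _ < ∞ := by
          rw [lintegral_mul_const _ (by fun_prop)]
          refine ENNReal.mul_lt_top ?_ hwfin
          exact (((integrableOn_Ioi_rpow_of_lt (by norm_num) ht₀pos).const_mul _).lintegral_lt_top)

end LaplaceIntegral

/-! ### Concentration of the interference -/

section Concentration

variable {L : ℝ → ℝ} {H : Measure ℝ}

lemma PhysicallyFeasible.lintegral_norm (hL : PhysicallyFeasible L) :
    ∫⁻ x : Plane, ENNReal.ofReal (L ‖x‖) = ENNReal.ofReal (2 * Real.pi * pathLossGamma L) := by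
  have hint : Integrable (fun x : Plane => L ‖x‖) := by
    rw [integrable_fun_norm_addHaar]
    simpa using hL.integrable
  rw [← ofReal_integral_eq_lintegral_ofReal hint (ae_of_all _ fun x => hL.nonneg _ (norm_nonneg _)),
    integral_fun_norm_addHaar]
  congr 1
  have hball : (volume : Measure Plane).real (Metric.ball 0 1) = Real.pi := by
    rw [measureReal_def, EuclideanSpace.volume_ball_fin_two]
    simp [Real.pi_pos.le]
  simp only [finrank_euclideanSpace, Fintype.card_fin, hball, smul_eq_mul, nsmul_eq_mul,
    pathLossGamma, Nat.add_one_sub_one, pow_one]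
  push_cast
  ring

lemma tendsto_inv_mul_one_sub_exp (c : ℝ) :
    Tendsto (fun t : ℝ => t⁻¹ * (1 - Real.exp (-(t * c)))) (𝓝[>] 0) (𝓝 c) := by
  have h : HasDerivAt (fun t : ℝ => -Real.exp (-(t * c))) c 0 := by
    have := (((hasDerivAt_id (0 : ℝ)).mul_const c).fun_neg.exp).fun_neg
    simpa using this
  refine h.tendsto_slope_zero_right.congr fun t => ?_
  simp only [zero_add, smul_eq_mul, zero_mul, neg_zero, Real.exp_zero]
  ring

lemma inv_mul_one_sub_exp_le {t c : ℝ} (ht : 0 < t) : t⁻¹ * (1 - Real.exp (-(t * c))) ≤ c := by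
  rw [inv_mul_le_iff₀ ht]
  linarith [Real.add_one_le_exp (-(t * c))]

/-- The Laplace transform has right derivative `-1` at `0`. The difference quotients are dominated
by `v * y`, so the first moment is enough. -/
lemma UnitMeanFading.tendsto_inv_mul_one_sub_fadingLaplace (hH : UnitMeanFading H) {v : ℝ}
    (hv : 0 ≤ v) :
    Tendsto (fun t : ℝ => t⁻¹ * (1 - fadingLaplace H (t * v))) (𝓝[>] 0) (𝓝 v) := by
  have hlim : Tendsto (fun t : ℝ => ∫ y, t⁻¹ * (1 - Real.exp (-(t * (v * y)))) ∂H) (𝓝[>] 0)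
      (𝓝 (∫ y, v * y ∂H)) := by
    refine tendsto_integral_filter_of_dominated_convergence (fun y => v * y)
      (Eventually.of_forall fun t => by fun_prop) ?_ (hH.integrable.const_mul v)
      (ae_of_all _ fun y => tendsto_inv_mul_one_sub_exp _)
    filter_upwards [self_mem_nhdsWithin] with t ht
    filter_upwards [hH.nonneg] with y hy
    have ht0 : 0 < t := ht
    have hexp : Real.exp (-(t * (v * y))) ≤ 1 := Real.exp_le_one_iff.2 (by
      have : 0 ≤ t * (v * y) := by positivity
      linarith)
    rw [Real.norm_of_nonneg (mul_nonneg (inv_nonneg.2 ht0.le) (by linarith))]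
    exact inv_mul_one_sub_exp_le ht0
  rw [integral_const_mul, hH.mean_one, mul_one] at hlim
  refine hlim.congr' ?_
  filter_upwards [self_mem_nhdsWithin] with t ht
  have ht0 : 0 < t := ht
  rw [integral_const_mul, hH.one_sub_fadingLaplace (by positivity)]
  simp only [mul_assoc]

lemma UnitMeanFading.tendsto_integral_one_sub_fadingLaplace (hH : UnitMeanFading H)
    {g : Plane → ℝ} (hg : ∀ x, 0 ≤ g x) (hgi : Integrable g) :
    Tendsto (fun t : ℝ => t⁻¹ * ∫ x, (1 - fadingLaplace H (t * g x))) (𝓝[>] 0) (𝓝 (∫ x, g x)) := by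
  simp_rw [← integral_const_mul]
  refine tendsto_integral_filter_of_dominated_convergence g
    (Eventually.of_forall fun t => ?_) ?_ hgi
    (ae_of_all _ fun x => hH.tendsto_inv_mul_one_sub_fadingLaplace (hg x))
  · have h1 := hH.measurable_fadingLaplace.comp_aemeasurable (hgi.aemeasurable.const_mul t)
    exact ((aemeasurable_const.sub h1).const_mul _).aestronglyMeasurable
  · filter_upwards [self_mem_nhdsWithin] with t ht
    refine ae_of_all _ fun x => ?_
    have ht0 : 0 < t := ht
    have h0 : 0 ≤ t * g x := mul_nonneg ht0.le (hg x)
    rw [Real.norm_of_nonneg (mul_nonneg (inv_nonneg.2 ht0.le)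
      (sub_nonneg.2 (hH.fadingLaplace_le_one h0))), inv_mul_le_iff₀ ht0]
    exact hH.one_sub_fadingLaplace_le h0

/-- A simple path loss of finite support, vanishing near the origin, of almost full mass. -/
lemma PhysicallyFeasible.exists_simpleFunc (hL : PhysicallyFeasible L) {a : ℝ} (ha : 0 < a)
    (haγ : a < 2 * Real.pi * pathLossGamma L) :
    ∃ δ : ℝ, 0 < δ ∧ ∃ g : SimpleFunc Plane ℝ≥0, (∀ x, (g x : ℝ≥0∞) ≤ ENNReal.ofReal (L ‖x‖)) ∧
      (∀ x, ‖x‖ ≤ δ → g x = 0) ∧ volume {x | g x ≠ 0} < ∞ ∧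
      Integrable (fun x => (g x : ℝ)) ∧ a < ∫ x, (g x : ℝ) := by
  have hL0 : 0 ≤ L 0 := hL.nonneg 0 le_rfl
  set G := 2 * Real.pi * pathLossGamma L with hG
  -- The disc of radius `δ` carries mass at most `L 0 * π * δ² < G - a`, so more than `a` remains
  -- outside it.
  set δ := √((G - a) / (2 * Real.pi * (L 0 + 1))) with hδ
  have hq : 0 < (G - a) / (2 * Real.pi * (L 0 + 1)) := by
    have := Real.pi_pos
    have : 0 < G - a := by linarith
    positivity
  have hδ0 : 0 < δ := Real.sqrt_pos.2 hq
  have hδ2 : L 0 * (Real.pi * δ ^ 2) < G - a := by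
    rw [hδ, Real.sq_sqrt hq.le]
    have h1 : L 0 * (Real.pi * ((G - a) / (2 * Real.pi * (L 0 + 1)))) =
        (G - a) * (L 0 / (2 * (L 0 + 1))) := by
      have := Real.pi_pos
      field_simp
    rw [h1]
    have : L 0 / (2 * (L 0 + 1)) < 1 := by
      rw [div_lt_one (by positivity)]; linarith
    nlinarith
  set A := Metric.closedBall (0 : Plane) δ with hA
  have hAm : MeasurableSet A := measurableSet_closedBall
  set f : Plane → ℝ≥0 := Aᶜ.indicator fun x => (L ‖x‖).toNNReal with hf
  have hflt : ENNReal.ofReal a < ∫⁻ x, f x := by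
    by_contra hcon
    rw [not_lt] at hcon
    have h1 : ∫⁻ x in A, ENNReal.ofReal (L ‖x‖) ≤ ENNReal.ofReal (L 0 * (Real.pi * δ ^ 2)) := by
      calc ∫⁻ x in A, ENNReal.ofReal (L ‖x‖) ≤ ∫⁻ x in A, ENNReal.ofReal (L 0) :=
            lintegral_mono fun x => ENNReal.ofReal_le_ofReal (hL.le_zero _ (norm_nonneg _))
        _ = ENNReal.ofReal (L 0 * (Real.pi * δ ^ 2)) := by
            rw [setLIntegral_const, ENNReal.ofReal_mul hL0, ← volume_closedBall_toReal hδ0.le,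
              ENNReal.ofReal_toReal (volume_closedBall_lt_top _).ne]
    have h2 : ∫⁻ x in Aᶜ, ENNReal.ofReal (L ‖x‖) = ∫⁻ x, f x := by
      rw [← lintegral_indicator hAm.compl]
      refine lintegral_congr fun x => ?_
      by_cases hx : x ∈ Aᶜ
      · rw [hf, indicator_of_mem hx, indicator_of_mem hx]; rfl
      · rw [hf, indicator_of_notMem hx, indicator_of_notMem hx]; rfl
    have h3 := lintegral_add_compl (fun x : Plane => ENNReal.ofReal (L ‖x‖)) hAm (μ := volume)
    rw [hL.lintegral_norm, h2] at h3
    have h4 := add_le_add h1 hcon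
    rw [h3, ← ENNReal.ofReal_add (by positivity) ha.le,
      ENNReal.ofReal_le_ofReal_iff (by positivity)] at h4
    linarith
  obtain ⟨g, hgf, hgfin, hga⟩ := exists_lt_lintegral_simpleFunc_of_lt_lintegral hflt
  have hgi : Integrable (fun x => (g x : ℝ)) := by
    refine ⟨(measurable_coe_nnreal_real.comp g.measurable).aestronglyMeasurable, ?_⟩
    rw [hasFiniteIntegral_iff_ofReal (ae_of_all _ fun x => NNReal.coe_nonneg _)]
    simpa using hgfin
  refine ⟨δ, hδ0, g, fun x => ?_, fun x hx => ?_, ?_, hgi, ?_⟩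
  · calc (g x : ℝ≥0∞) ≤ f x := ENNReal.coe_le_coe.2 (hgf x)
      _ ≤ ((L ‖x‖).toNNReal : ℝ≥0∞) := ENNReal.coe_le_coe.2 (indicator_le_self _ _ x)
  · have hxA : x ∉ Aᶜ := by simpa [hA] using hx
    have := hgf x
    rw [hf, indicator_of_notMem hxA] at this
    exact le_antisymm this zero_le
  · have h1 : (g.map fun v : ℝ≥0 => (v : ℝ≥0∞)).lintegral volume ≠ ∞ := by
      rw [← SimpleFunc.lintegral_eq_lintegral]
      exact hgfin.ne
    have h2 := SimpleFunc.finMeasSupp_iff_support.1 (SimpleFunc.FinMeasSupp.of_lintegral_ne_top h1)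
    convert h2 using 2
    ext x
    simp
  · have h1 : ∫⁻ x, (g x : ℝ≥0∞) = ENNReal.ofReal (∫ x, (g x : ℝ)) := by
      rw [ofReal_integral_eq_lintegral_ofReal hgi (ae_of_all _ fun x => NNReal.coe_nonneg _)]
      simp
    rw [h1] at hga
    exact (ENNReal.ofReal_lt_ofReal_iff_of_nonneg ha.le).1 hga

/-- The lower tail of the interference is exponentially small in the intensity. -/
lemma exists_measure_interference_le (hL : PhysicallyFeasible L) (hH : UnitMeanFading H) {a : ℝ}
    (ha : 0 < a) (haγ : a < 2 * Real.pi * pathLossGamma L) :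
    ∃ κ : ℝ, 0 < κ ∧ ∀ lam : ℝ, 0 ≤ lam →
      ∀ (Ω : Type*) [MeasurableSpace Ω] (P : Measure Ω) (X : ℕ → Ω → Plane) (h : ℕ → Ω → ℝ),
        IsCellularNetwork P lam H X h →
        P {ω | interference L X h ω ≤ ENNReal.ofReal (a * lam)} ≤
          ENNReal.ofReal (2 * Real.exp (-(κ * lam))) := by
  obtain ⟨δ, hδ, g, hgL, hg0, hgs, hgi, hga⟩ := hL.exists_simpleFunc ha haγ
  have hev := (hH.tendsto_integral_one_sub_fadingLaplace (fun x => NNReal.coe_nonneg (g x))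
    hgi).eventually (lt_mem_nhds hga)
  -- A small Chernoff parameter, for which `∫ (1 - fadingLaplace H (t * g))` still exceeds `t * a`;
  -- the exponent is then a negative multiple of `lam`.
  obtain ⟨t, hat, ht⟩ := (hev.and self_mem_nhdsWithin).exists
  have ht0 : 0 < t := ht
  set J := ∫ x, (1 - fadingLaplace H (t * g x)) with hJ
  have hκ : 0 < J - t * a := by
    rw [lt_inv_mul_iff₀ ht0] at hat
    linarith
  refine ⟨min (J - t * a) (Real.pi * δ ^ 2), lt_min hκ (by positivity),
    fun lam hlam Ω _ P X h hN => ?_⟩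
  set κ := min (J - t * a) (Real.pi * δ ^ 2)
  set T : ℝ≥0 := ⟨t, ht0.le⟩
  have hchern := hN.measure_tsum_le hH hlam (g.map fun v => T * v)
    ((measure_mono fun x hx => by
      simp only [SimpleFunc.map_apply, ne_eq, mul_eq_zero, not_or, mem_ofPred_eq] at hx
      exact hx.2).trans_lt hgs) (a := t * (a * lam)) (by positivity)
  simp only [SimpleFunc.map_apply, NNReal.coe_mul] at hchern
  have hsub : {ω | interference L X h ω ≤ ENNReal.ofReal (a * lam)} ⊆ discBad X δ ∪
      {ω | ∑' i, ENNReal.ofReal (h i ω) * ((T * g (X i ω) : ℝ≥0) : ℝ≥0∞) ≤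
        ENNReal.ofReal (t * (a * lam))} := fun ω hω => by
    by_cases hbad : ω ∈ discBad X δ
    · exact Or.inl hbad
    · refine Or.inr ?_
      have h1 := (tsum_le_interference hL (servingDist_le_of_notMem hbad) (h := h)
        (g := fun x => (g x : ℝ≥0∞)) hgL fun x hx => by simp [hg0 x hx]).trans hω
      have h2 : ENNReal.ofReal t = T := by
        rw [ENNReal.ofReal, Real.toNNReal_of_nonneg ht0.le]
        rfl
      rw [mem_ofPred_eq, ENNReal.ofReal_mul ht0.le, h2]
      calc ∑' i, ENNReal.ofReal (h i ω) * ((T * g (X i ω) : ℝ≥0) : ℝ≥0∞)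
          = T * ∑' i, ENNReal.ofReal (h i ω) * (g (X i ω) : ℝ≥0∞) := by
            rw [← ENNReal.tsum_mul_left]
            congr with i
            push_cast
            ring
        _ ≤ _ := by gcongr
  refine (measure_mono hsub).trans ((measure_union_le _ _).trans
    ((add_le_add (hN.poisson.measure_discBad_le hlam hδ.le) hchern).trans ?_))
  rw [← ENNReal.ofReal_add (Real.exp_pos _).le (Real.exp_pos _).le]
  refine ENNReal.ofReal_le_ofReal ?_
  have h1 : Real.exp (-(lam * (Real.pi * δ ^ 2))) ≤ Real.exp (-(κ * lam)) :=
    Real.exp_le_exp.2 (by nlinarith [min_le_right (J - t * a) (Real.pi * δ ^ 2)])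
  have h2 : Real.exp (t * (a * lam) - lam * J) ≤ Real.exp (-(κ * lam)) :=
    Real.exp_le_exp.2 (by nlinarith [min_le_left (J - t * a) (Real.pi * δ ^ 2)])
  have h3 : ∫ x, (1 - fadingLaplace H (T * g x)) = J := rfl
  rw [h3]
  linarith

end Concentration

/-! ### Measurability of the serving index, and the law of the serving fading power -/

section ServingLaw

/-- The index of the closest point, as a function of the configuration. -/
def closestIndex (ξ : ℕ → Plane) : ℕ := sInf {i | ∀ j, ‖ξ i‖ ≤ ‖ξ j‖}

lemma measurable_closestIndex : Measurable closestIndex := by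
  have hA : ∀ i, MeasurableSet {ξ : ℕ → Plane | ∀ j, ‖ξ i‖ ≤ ‖ξ j‖} := fun i => by
    rw [ofPred_forall]
    exact MeasurableSet.iInter fun j => measurableSet_le (by fun_prop) (by fun_prop)
  refine measurable_to_countable' fun n => ?_
  -- Either `n` is the first minimiser, or there is none and `sInf ∅ = 0`.
  have heq : closestIndex ⁻¹' {n} =
      ({ξ | ∀ j, ‖ξ n‖ ≤ ‖ξ j‖} ∩ ⋂ m ∈ Finset.range n, {ξ | ∀ j, ‖ξ m‖ ≤ ‖ξ j‖}ᶜ) ∪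
      ({ξ | n = 0} ∩ ⋂ m, {ξ | ∀ j, ‖ξ m‖ ≤ ‖ξ j‖}ᶜ) := by
    ext ξ
    simp only [mem_preimage, mem_singleton_iff, mem_union, mem_inter_iff, mem_iInter,
      mem_compl_iff, Finset.mem_range]
    set S : Set ℕ := {i | ∀ j, ‖ξ i‖ ≤ ‖ξ j‖} with hS
    have hmem : ∀ m, ξ ∈ {ξ : ℕ → Plane | ∀ j, ‖ξ m‖ ≤ ‖ξ j‖} ↔ m ∈ S := fun m => Iff.rfl
    simp only [hmem]
    change sInf S = n ↔ _
    constructor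
    · rintro rfl
      rcases S.eq_empty_or_nonempty with h | h
      · exact Or.inr ⟨by simp [h], fun m => by simp [h]⟩
      · exact Or.inl ⟨Nat.sInf_mem h, fun m hm => Nat.notMem_of_lt_sInf hm⟩
    · rintro (⟨h1, h2⟩ | ⟨h1, h2⟩)
      · refine le_antisymm (Nat.sInf_le h1) ?_
        by_contra hlt
        exact h2 _ (not_le.1 hlt) (Nat.sInf_mem ⟨n, h1⟩)
      · have : S = ∅ := eq_empty_iff_forall_notMem.2 h2
        have hn : n = 0 := h1
        simp [this, hn]
  rw [heq]
  exact ((hA n).inter (Finset.measurableSet_biInter _ fun m _ => (hA m).compl)).union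
    ((MeasurableSet.const _).inter (MeasurableSet.iInter fun m => (hA m).compl))

variable {Ω : Type*} [MeasurableSpace Ω] {P : Measure Ω} {lam : ℝ} {L : ℝ → ℝ} {H : Measure ℝ}
  {X : ℕ → Ω → Plane} {h : ℕ → Ω → ℝ}

lemma IsCellularNetwork.measurable_servingIndex (hN : IsCellularNetwork P lam H X h) :
    Measurable (servingIndex X) :=
  measurable_closestIndex.comp (measurable_pi_lambda (fun ω i => X i ω) hN.poisson.measurable)

lemma measurable_apply_index {α β : Type*} [MeasurableSpace α] [MeasurableSpace β] {k : α → ℕ}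
    (hk : Measurable k) {f : ℕ → α → β} (hf : ∀ i, Measurable (f i)) :
    Measurable fun ω => f (k ω) ω :=
  (measurable_from_prod_countable_left (f := fun p : α × ℕ => f p.2 p.1) hf).comp
    (measurable_id.prodMk hk)

lemma IsCellularNetwork.measurable_servingFading (hN : IsCellularNetwork P lam H X h) :
    Measurable fun ω => h (servingIndex X ω) ω :=
  measurable_apply_index hN.measurable_servingIndex hN.fading_measurable

lemma IsCellularNetwork.measurable_servingDist (hN : IsCellularNetwork P lam H X h) :
    Measurable (servingDist X) :=
  (measurable_apply_index hN.measurable_servingIndex hN.poisson.measurable).norm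

lemma IsCellularNetwork.measurable_interference (hN : IsCellularNetwork P lam H X h)
    (hL : PhysicallyFeasible L) : Measurable (interference L X h) := by
  refine Measurable.tsum fun i => ?_
  have hXi := (hN.poisson.measurable i).norm
  have h1 : Measurable fun ω => ENNReal.ofReal (h i ω * L ‖X i ω‖) :=
    ((hN.fading_measurable i).mul (hL.measurable.comp hXi)).ennreal_ofReal
  exact h1.indicator (measurableSet_lt hN.measurable_servingDist hXi)

/-- The fading power of the serving base station has law `H`. -/
lemma IsCellularNetwork.lintegral_servingFading (hN : IsCellularNetwork P lam H X h)
    {f : ℝ → ℝ≥0∞} (hf : Measurable f) :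
    ∫⁻ ω, f (h (servingIndex X ω) ω) ∂P = ∫⁻ y, f y ∂H := by
  have := hN.isProbabilityMeasure
  have hF : Measurable (Function.uncurry fun (ξ : ℕ → Plane) (η : ℕ → ℝ) =>
      f (η (closestIndex ξ))) :=
    hf.comp (measurable_apply_index (k := fun p : (ℕ → Plane) × (ℕ → ℝ) => closestIndex p.1)
      (f := fun i p => p.2 i) (measurable_closestIndex.comp measurable_fst) fun i => by fun_prop)
  have := hN.lintegral_joint hF
  change ∫⁻ ω, f (h (servingIndex X ω) ω) ∂P = _ at this
  rw [this]
  -- For frozen positions the serving index is a constant, and each fading power has law `H`.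
  simp_rw [fun i => hN.lintegral_comp_fading i hf]
  simp

lemma IsCellularNetwork.lintegral_interference_le (hN : IsCellularNetwork P lam H X h)
    (hL : PhysicallyFeasible L) (hH : UnitMeanFading H) (hlam : 0 ≤ lam) :
    ∫⁻ ω, interference L X h ω ∂P ≤ ENNReal.ofReal (2 * Real.pi * pathLossGamma L * lam) := by
  have hLn : Measurable fun x : Plane => ENNReal.ofReal (L ‖x‖) :=
    (hL.measurable.comp measurable_norm).ennreal_ofReal
  refine (lintegral_mono (interference_le_tsum hL)).trans (le_of_eq ?_)
  rw [lintegral_tsum (f := fun i ω => ENNReal.ofReal (h i ω) * ENNReal.ofReal (L ‖X i ω‖))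
    fun i => ((hN.fading_measurable i).ennreal_ofReal.mul
    (hLn.comp (hN.poisson.measurable i))).aemeasurable]
  have hterm : ∀ i, ∫⁻ ω, ENNReal.ofReal (h i ω) * ENNReal.ofReal (L ‖X i ω‖) ∂P =
      ∫⁻ ω, ENNReal.ofReal (L ‖X i ω‖) ∂P := fun i => by
    rw [hN.lintegral_joint (F := fun ξ η => ENNReal.ofReal (η i) * ENNReal.ofReal (L ‖ξ i‖))]
    · refine lintegral_congr fun ω => ?_
      rw [lintegral_mul_const _ (hN.fading_measurable i).ennreal_ofReal,
        hN.lintegral_comp_fading i (f := ENNReal.ofReal) (by fun_prop), hH.lintegral_ofReal,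
        one_mul]
    · have h1 : Measurable fun p : (ℕ → Plane) × (ℕ → ℝ) => ENNReal.ofReal (L ‖p.1 i‖) :=
        hLn.comp ((measurable_pi_apply i).comp measurable_fst)
      have h2 : Measurable fun p : (ℕ → Plane) × (ℕ → ℝ) => ENNReal.ofReal (p.2 i) := by fun_prop
      exact h2.mul h1
  simp_rw [hterm]
  rw [hN.poisson.lintegral_tsum hLn, hL.lintegral_norm, mul_comm,
    ← ENNReal.ofReal_mul' hlam]

/-- The upper tail of the interference, from its mean and its lower tail. -/
lemma IsCellularNetwork.measure_interference_gt_le (hN : IsCellularNetwork P lam H X h)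
    (hL : PhysicallyFeasible L) (hH : UnitMeanFading H) (hlam : 0 < lam) {a b : ℝ} (ha : 0 ≤ a)
    (hab : a ≤ b) :
    (b - a) * P.real {ω | ENNReal.ofReal (b * lam) < interference L X h ω} ≤
      2 * Real.pi * pathLossGamma L - a +
        a * P.real {ω | interference L X h ω ≤ ENNReal.ofReal (a * lam)} := by
  have := hN.isProbabilityMeasure
  have hIm := hN.measurable_interference hL
  set U := {ω | ENNReal.ofReal (b * lam) < interference L X h ω}
  set V := {ω | interference L X h ω ≤ ENNReal.ofReal (a * lam)}
  have hU : MeasurableSet U := measurableSet_lt measurable_const hIm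
  have hV : MeasurableSet V := measurableSet_le hIm measurable_const
  -- If the interference is rarely below `a * lam`, with `a` close to the mean rate, the mean leaves
  -- little room for an excess `(b - a) * lam` on `U`.
  have hpt : ∀ ω, Vᶜ.indicator (fun _ => ENNReal.ofReal (a * lam)) ω +
      U.indicator (fun _ => ENNReal.ofReal ((b - a) * lam)) ω ≤ interference L X h ω := fun ω => by
    by_cases hωV : ω ∈ V
    · have hωU : ω ∉ U := fun hωU => by
        have h1 : ENNReal.ofReal (a * lam) ≤ ENNReal.ofReal (b * lam) :=
          ENNReal.ofReal_le_ofReal (by nlinarith)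
        exact absurd (hωU.trans_le (hωV.trans h1)) (lt_irrefl _)
      simp [hωV, hωU]
    · rw [indicator_of_mem (show ω ∈ Vᶜ from hωV)]
      by_cases hωU : ω ∈ U
      · rw [indicator_of_mem hωU, ← ENNReal.ofReal_add (by positivity)
          (mul_nonneg (by linarith) hlam.le)]
        refine le_trans (le_of_eq ?_) (le_of_lt hωU)
        ring_nf
      · rw [indicator_of_notMem hωU, add_zero]
        exact (not_le.1 hωV).le
  have h1 := (lintegral_mono hpt).trans (hN.lintegral_interference_le hL hH hlam.le)
  rw [lintegral_add_left (measurable_const.indicator hV.compl), lintegral_indicator_const hV.compl,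
    lintegral_indicator_const hU, ← ofReal_measureReal (μ := P) (s := Vᶜ),
    ← ofReal_measureReal (μ := P) (s := U), ← ENNReal.ofReal_mul (by positivity),
    ← ENNReal.ofReal_mul (mul_nonneg (by linarith) hlam.le),
    ← ENNReal.ofReal_add (by positivity)
      (mul_nonneg (mul_nonneg (by linarith) hlam.le) measureReal_nonneg),
    ENNReal.ofReal_le_ofReal_iff (by have := hL.gamma_pos; positivity), probReal_compl_eq_one_sub hV]
    at h1
  have h2 : lam * (a * (1 - P.real V) + (b - a) * P.real U) ≤
      lam * (2 * Real.pi * pathLossGamma L) := by linarith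
  have h3 := le_of_mul_le_mul_left h2 hlam
  linarith

end ServingLaw

/-! ### Upper bound for the area spectral efficiency -/

section UpperBound

/-- From `log (1 + x) ≤ 2 √x` and a weighted AM-GM inequality. The coefficient of `x` vanishes as
`lam → ∞`, at the price of a polynomial term to be multiplied by an exponentially small probability.
-/
lemma mul_log_one_add_le {x lam : ℝ} (hx : 0 ≤ x) (hlam : 0 < lam) :
    lam * Real.log (1 + x) ≤ x * lam⁻¹ + lam ^ 3 := by
  have hs := Real.sqrt_nonneg x
  have h1 : Real.log (1 + x) ≤ 2 * √x := by
    calc Real.log (1 + x) ≤ Real.log ((1 + √x) ^ 2) :=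
          Real.log_le_log (by positivity) (by nlinarith [Real.sq_sqrt hx])
      _ = 2 * Real.log (1 + √x) := by rw [Real.log_pow]; norm_num
      _ ≤ 2 * √x := by linarith [Real.log_le_sub_one_of_pos (show 0 < 1 + √x by positivity)]
  have h2 : 2 * √x ≤ x * lam⁻¹ ^ 2 + lam ^ 2 := by
    have h3 : √x * lam⁻¹ * lam = √x := by field_simp
    have h4 : (√x * lam⁻¹) ^ 2 = x * lam⁻¹ ^ 2 := by rw [mul_pow, Real.sq_sqrt hx]
    nlinarith [sq_nonneg (√x * lam⁻¹ - lam)]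
  calc lam * Real.log (1 + x) ≤ lam * (x * lam⁻¹ ^ 2 + lam ^ 2) := by gcongr; linarith
    _ = x * lam⁻¹ + lam ^ 3 := by field_simp

/-- Splitting the product through `1 + x y ≤ (1 + x) (1 + y)` means that only separate means of the
serving fading power and of the inverse interference are needed. -/
lemma mul_log_one_add_mul_le {x y lam : ℝ} (hx : 0 ≤ x) (hy : 0 ≤ y) (hlam : 0 < lam) :
    lam * Real.log (1 + x * y) ≤ (x + y) * lam⁻¹ + 2 * lam ^ 3 := by
  have h1 : Real.log (1 + x * y) ≤ Real.log (1 + x) + Real.log (1 + y) := by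
    rw [← Real.log_mul (by positivity) (by positivity)]
    exact Real.log_le_log (by positivity) (by nlinarith)
  nlinarith [mul_log_one_add_le hx hlam, mul_log_one_add_le hy hlam]

variable {Ω : Type*} [MeasurableSpace Ω] {P : Measure Ω} {lam : ℝ} {L : ℝ → ℝ} {H : Measure ℝ}
  {X : ℕ → Ω → Plane} {h : ℕ → Ω → ℝ}

/-- Where the interference exceeds `a * lam`, `log (1 + x) ≤ x` gives the main term. On the
complement `mul_log_one_add_mul_le` gives the other two. Noise only lowers the SINR. -/
lemma IsCellularNetwork.averageASE_le (hN : IsCellularNetwork P lam H X h)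
    (hL : PhysicallyFeasible L) (hH : UnitMeanFading H) (hlam : 0 < lam) {a : ℝ} (ha : 0 < a)
    (N₀ : ℝ) :
    averageASE P lam L N₀ X h ≤ ENNReal.ofReal (Real.log 2)⁻¹ *
      (ENNReal.ofReal (L 0 / a) +
        (1 + ENNReal.ofReal (L 0) * ∫⁻ ω, (interference L X h ω)⁻¹ ∂P) * ENNReal.ofReal lam⁻¹ +
        ENNReal.ofReal (2 * lam ^ 3) *
          P {ω | interference L X h ω ≤ ENNReal.ofReal (a * lam)}) := by
  have hIm := hN.measurable_interference hL
  have hL0 : 0 ≤ L 0 := hL.nonneg 0 le_rfl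
  have hlog2 : 0 < Real.log 2 := Real.log_pos one_lt_two
  set V := {ω | interference L X h ω ≤ ENNReal.ofReal (a * lam)}
  have hV : MeasurableSet V := measurableSet_le hIm measurable_const
  set h₀ : Ω → ℝ := fun ω => h (servingIndex X ω) ω with hh₀
  have hh₀m : Measurable h₀ := hN.measurable_servingFading
  have hpt : ∀ᵐ ω ∂P, ENNReal.ofReal lam *
      ENNReal.ofReal (Real.logb 2 (1 + (sinr L N₀ X h ω).toReal)) ≤
      ENNReal.ofReal (Real.log 2)⁻¹ * (ENNReal.ofReal (h₀ ω) * ENNReal.ofReal (L 0 / a) +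
        (ENNReal.ofReal (h₀ ω) + ENNReal.ofReal (L 0) * (interference L X h ω)⁻¹) *
          ENNReal.ofReal lam⁻¹ + V.indicator (fun _ => ENNReal.ofReal (2 * lam ^ 3)) ω) := by
    filter_upwards [hN.ae_fading_nonneg hH] with ω hω
    have hh : 0 ≤ h₀ ω := hω _
    rw [← ENNReal.ofReal_mul hlam.le, Real.logb, div_eq_inv_mul, mul_left_comm,
      ENNReal.ofReal_mul (by positivity)]
    gcongr
    have hs : sinr L N₀ X h ω ≤ ENNReal.ofReal (h₀ ω * L 0) / interference L X h ω := by
      refine ENNReal.div_le_div (ENNReal.ofReal_le_ofReal ?_) le_self_add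
      exact mul_le_mul_of_nonneg_left (hL.le_zero _ (norm_nonneg _)) hh
    by_cases hωV : ω ∈ V
    · rw [indicator_of_mem hωV]
      set y := ENNReal.ofReal (L 0) * (interference L X h ω)⁻¹ with hy
      by_cases hytop : y = ∞
      · rw [hytop, add_top, ENNReal.top_mul (by simpa using hlam), add_top, top_add]
        exact le_top
      · have hs2 : (sinr L N₀ X h ω).toReal ≤ h₀ ω * y.toReal := by
          rw [← ENNReal.toReal_ofReal hh, ← ENNReal.toReal_mul]
          refine ENNReal.toReal_mono (ENNReal.mul_ne_top ENNReal.ofReal_ne_top hytop) ?_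
          refine hs.trans (le_of_eq ?_)
          rw [hy, ENNReal.ofReal_mul hh, div_eq_mul_inv, mul_assoc]
        have h1 : lam * Real.log (1 + (sinr L N₀ X h ω).toReal) ≤
            (h₀ ω + y.toReal) * lam⁻¹ + 2 * lam ^ 3 := by
          refine le_trans ?_ (mul_log_one_add_mul_le hh ENNReal.toReal_nonneg hlam)
          gcongr
        refine (ENNReal.ofReal_le_ofReal h1).trans ?_
        rw [ENNReal.ofReal_add (by positivity) (by positivity), ENNReal.ofReal_mul (by positivity),
          ENNReal.ofReal_add hh ENNReal.toReal_nonneg, ENNReal.ofReal_toReal hytop]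
        gcongr
        exact le_add_self
    · rw [indicator_of_notMem hωV]
      have hI : ENNReal.ofReal (a * lam) ≤ interference L X h ω := (not_le.1 hωV).le
      have hal : 0 < a * lam := by positivity
      have hs2 : (sinr L N₀ X h ω).toReal ≤ h₀ ω * L 0 / (a * lam) := by
        refine ENNReal.toReal_le_of_le_ofReal (by positivity) ?_
        rw [ENNReal.ofReal_div_of_pos hal]
        exact hs.trans (ENNReal.div_le_div_left hI _)
      have h1 : lam * Real.log (1 + (sinr L N₀ X h ω).toReal) ≤ h₀ ω * (L 0 / a) := by
        have h2 := Real.log_le_sub_one_of_pos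
          (show 0 < 1 + (sinr L N₀ X h ω).toReal by positivity)
        calc lam * Real.log (1 + (sinr L N₀ X h ω).toReal) ≤ lam * (h₀ ω * L 0 / (a * lam)) := by
              gcongr; linarith
          _ = h₀ ω * (L 0 / a) := by field_simp
      refine (ENNReal.ofReal_le_ofReal h1).trans ?_
      rw [ENNReal.ofReal_mul hh, add_assoc]
      exact le_self_add
  have hmean : ∫⁻ ω, ENNReal.ofReal (h₀ ω) ∂P = 1 := by
    rw [hN.lintegral_servingFading (f := ENNReal.ofReal) (by fun_prop), hH.lintegral_ofReal]
  unfold averageASE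
  rw [← lintegral_const_mul' _ _ ENNReal.ofReal_ne_top]
  refine (lintegral_mono_ae hpt).trans (le_of_eq ?_)
  have m1 : Measurable fun ω => ENNReal.ofReal (h₀ ω) := hh₀m.ennreal_ofReal
  rw [lintegral_const_mul' _ _ ENNReal.ofReal_ne_top,
    lintegral_add_right _ (measurable_const.indicator hV),
    lintegral_add_left (m1.mul_const _), lintegral_mul_const _ m1, hmean, one_mul,
    lintegral_mul_const' _ _ ENNReal.ofReal_ne_top, lintegral_add_left m1, hmean,
    lintegral_const_mul' _ _ ENNReal.ofReal_ne_top, lintegral_indicator_const hV]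

lemma lintegral_inv_interference_le [IsProbabilityMeasure P] :
    ∫⁻ ω, (interference L X h ω)⁻¹ ∂P ≤ 1 + secondNegativeMoment P L X h := by
  calc ∫⁻ ω, (interference L X h ω)⁻¹ ∂P
      ≤ ∫⁻ ω, (1 + (interference L X h ω ^ 2)⁻¹) ∂P := by
        refine lintegral_mono fun ω => ?_
        rw [ENNReal.inv_pow]
        generalize (interference L X h ω)⁻¹ = y
        rcases le_total y 1 with hy | hy
        · exact hy.trans le_self_add
        · exact (le_self_pow₀ hy two_ne_zero).trans le_add_self
    _ = 1 + secondNegativeMoment P L X h := by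
        rw [lintegral_add_left measurable_const]
        simp [secondNegativeMoment]

end UpperBound

/-! ### Lower bound for the area spectral efficiency -/

section LowerBound

variable {Ω : Type*} [MeasurableSpace Ω] {P : Measure Ω} {lam : ℝ} {L : ℝ → ℝ} {H : Measure ℝ}
  {X : ℕ → Ω → Plane} {h : ℕ → Ω → ℝ}

/-- The serving base station is possibly far, or the interference is atypical. -/
def atypical (L : ℝ → ℝ) (X : ℕ → Ω → Plane) (h : ℕ → Ω → ℝ) (lam δ a b : ℝ) : Set Ω :=
  discBad X δ ∪ {ω | interference L X h ω ≤ ENNReal.ofReal (a * lam)} ∪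
    {ω | ENNReal.ofReal (b * lam) < interference L X h ω}

lemma UnitMeanFading.integrable_min (hH : UnitMeanFading H) {M : ℝ} (hM : 0 ≤ M) :
    Integrable (fun y => min y M) H := by
  refine hH.integrable.mono (by fun_prop) ?_
  filter_upwards [hH.nonneg] with y hy
  rw [Real.norm_of_nonneg hy, Real.norm_of_nonneg (le_min hy hM)]
  exact min_le_left _ _

lemma UnitMeanFading.tendsto_integral_min (hH : UnitMeanFading H) :
    Tendsto (fun n : ℕ => ∫ y, min y n ∂H) atTop (𝓝 1) := by
  rw [← hH.mean_one]
  refine tendsto_integral_of_dominated_convergence (fun y => y) (fun n => by fun_prop)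
    hH.integrable (fun n => ?_) (ae_of_all _ fun y => ?_)
  · filter_upwards [hH.nonneg] with y hy
    rw [Real.norm_of_nonneg (le_min hy n.cast_nonneg)]
    exact min_le_left _ _
  · refine tendsto_const_nhds.congr' ?_
    filter_upwards [eventually_ge_atTop ⌈y⌉₊] with n hn
    exact (min_eq_left ((Nat.le_ceil y).trans (by exact_mod_cast hn))).symm

lemma div_one_add_le_mul_log {x Y lam : ℝ} (hlam : 0 < lam) (hx : 0 ≤ x) (hxY : x ≤ Y) :
    x / (1 + Y / lam) ≤ lam * Real.log (1 + x / lam) := by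
  have hpos : 0 < 1 + x / lam := by positivity
  have h1 := Real.one_sub_inv_le_log_of_pos hpos
  calc x / (1 + Y / lam) ≤ x / (1 + x / lam) := by gcongr
    _ = lam * (1 - (1 + x / lam)⁻¹) := by field_simp; ring
    _ ≤ _ := by gcongr

/-- Off the atypical event the SINR is at least `h₀ l / (b' lam)`, the noise being absorbed in `b'`.
Capping `h₀` at `M` makes the logarithm almost linear and bounds the loss on the atypical event by
`M` times its probability, whatever the dependence. -/
lemma IsCellularNetwork.le_averageASE (hN : IsCellularNetwork P lam H X h)
    (hL : PhysicallyFeasible L) (hH : UnitMeanFading H) (hlam : 0 < lam)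
    {N₀ : ℝ} (hN₀ : 0 ≤ N₀) {δ l a b b' M : ℝ} (hl : 0 ≤ l)
    (hδl : ∀ r, 0 ≤ r → r ≤ δ → l ≤ L r) (hb : 0 < b)
    (hNb : b * lam + N₀ ≤ b' * lam) (hM : 0 ≤ M) :
    ENNReal.ofReal ((l / (b' * Real.log 2)) / (1 + M * (l / b') / lam) *
      (∫ y, min y M ∂H - M * P.real (atypical L X h lam δ a b))) ≤ averageASE P lam L N₀ X h := by
  have := hN.isProbabilityMeasure
  have hIm := hN.measurable_interference hL
  have hlog2 : 0 < Real.log 2 := Real.log_pos one_lt_two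
  have hb' : 0 < b' := by
    by_contra hcon
    nlinarith [mul_pos hb hlam]
  set E := atypical L X h lam δ a b with hE
  have hEm : MeasurableSet E := ((hN.poisson.measurableSet_discBad δ).union
    (measurableSet_le hIm measurable_const)).union (measurableSet_lt measurable_const hIm)
  set h₀ : Ω → ℝ := fun ω => h (servingIndex X ω) ω with hh₀
  have hh₀m : Measurable h₀ := hN.measurable_servingFading
  set κ := (l / (b' * Real.log 2)) / (1 + M * (l / b') / lam) with hκ
  have hκ0 : 0 ≤ κ := by positivity
  have hpt : ∀ᵐ ω ∂P, ENNReal.ofReal (κ * min (h₀ ω) M) ≤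
      ENNReal.ofReal lam * ENNReal.ofReal (Real.logb 2 (1 + (sinr L N₀ X h ω).toReal)) +
        E.indicator (fun _ => ENNReal.ofReal (κ * M)) ω := by
    filter_upwards [hN.ae_fading_nonneg hH] with ω hω
    have hh : 0 ≤ h₀ ω := hω _
    have hm0 : 0 ≤ min (h₀ ω) M := le_min hh hM
    by_cases hωE : ω ∈ E
    · rw [indicator_of_mem hωE]
      refine le_trans (ENNReal.ofReal_le_ofReal ?_) le_add_self
      exact mul_le_mul_of_nonneg_left (min_le_right _ _) hκ0
    · rw [indicator_of_notMem hωE, add_zero, ← ENNReal.ofReal_mul hlam.le]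
      refine ENNReal.ofReal_le_ofReal ?_
      rw [hE, atypical, mem_union, mem_union, not_or, not_or] at hωE
      obtain ⟨⟨h1, h2⟩, h3⟩ := hωE
      have hlow : ENNReal.ofReal (a * lam) < interference L X h ω := not_le.1 h2
      have hupp : interference L X h ω ≤ ENNReal.ofReal (b * lam) := not_lt.1 h3
      have hLR : l ≤ L (servingDist X ω) :=
        hδl _ (norm_nonneg _) (servingDist_le_of_notMem h1)
      have hsle : ENNReal.ofReal (h₀ ω * l / (b' * lam)) ≤ sinr L N₀ X h ω := by
        rw [ENNReal.ofReal_div_of_pos (by positivity)]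
        refine ENNReal.div_le_div (ENNReal.ofReal_le_ofReal ?_) ?_
        · exact mul_le_mul_of_nonneg_left hLR hh
        · calc interference L X h ω + ENNReal.ofReal N₀
              ≤ ENNReal.ofReal (b * lam) + ENNReal.ofReal N₀ := by gcongr
            _ = ENNReal.ofReal (b * lam + N₀) := (ENNReal.ofReal_add (by positivity) hN₀).symm
            _ ≤ _ := ENNReal.ofReal_le_ofReal hNb
      -- `toReal` sends `∞` to `0`, so a lower bound on the SINR survives only if it is finite; the
      -- strict lower cut-off on the interference ensures this.
      have hsfin : sinr L N₀ X h ω ≠ ∞ := by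
        refine ENNReal.div_ne_top ENNReal.ofReal_ne_top ?_
        have : 0 < interference L X h ω := zero_le.trans_lt hlow
        exact (this.trans_le le_self_add).ne'
      have hs : h₀ ω * l / (b' * lam) ≤ (sinr L N₀ X h ω).toReal :=
        (ENNReal.ofReal_le_iff_le_toReal hsfin).1 hsle
      set x := min (h₀ ω) M * (l / b') with hx
      have hx0 : 0 ≤ x := by positivity
      have hxs : x / lam ≤ (sinr L N₀ X h ω).toReal := by
        refine le_trans ?_ hs
        have : h₀ ω * l / (b' * lam) = h₀ ω * (l / b') / lam := by field_simp
        rw [this, hx]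
        gcongr
        exact min_le_left _ _
      have hxM : x ≤ M * (l / b') := by rw [hx]; gcongr; exact min_le_right _ _
      calc κ * min (h₀ ω) M = x / (1 + M * (l / b') / lam) / Real.log 2 := by
            rw [hκ, hx]; field_simp
        _ ≤ lam * Real.log (1 + x / lam) / Real.log 2 := by
            gcongr; exact div_one_add_le_mul_log hlam hx0 hxM
        _ ≤ lam * Real.log (1 + (sinr L N₀ X h ω).toReal) / Real.log 2 := by gcongr
        _ = _ := by rw [Real.logb, mul_div_assoc]
  have hmean : ∫⁻ ω, ENNReal.ofReal (κ * min (h₀ ω) M) ∂P =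
      ENNReal.ofReal (κ * ∫ y, min y M ∂H) := by
    rw [hN.lintegral_servingFading (f := fun y => ENNReal.ofReal (κ * min y M)) (by fun_prop),
      ← integral_const_mul, ofReal_integral_eq_lintegral_ofReal
        ((hH.integrable_min hM).const_mul _)]
    filter_upwards [hH.nonneg] with y hy
    exact mul_nonneg hκ0 (le_min hy hM)
  have hint := lintegral_mono_ae hpt
  rw [hmean, lintegral_add_right _ (measurable_const.indicator hEm),
    lintegral_const_mul' _ _ ENNReal.ofReal_ne_top, lintegral_indicator_const hEm,
    ← ofReal_measureReal (μ := P) (s := E), ← ENNReal.ofReal_mul (by positivity)] at hint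
  rw [mul_sub, ENNReal.ofReal_sub _ (by positivity), tsub_le_iff_right, ← mul_assoc]
  exact hint

end LowerBound

/-! ### The limit of the area spectral efficiency -/

section Limit

variable {L : ℝ → ℝ} {H : Measure ℝ} {Ω : ℝ → Type*} [∀ lam, MeasurableSpace (Ω lam)]
  {P : ∀ lam, Measure (Ω lam)} {X : ∀ lam, ℕ → Ω lam → Plane} {h : ∀ lam, ℕ → Ω lam → ℝ}

lemma tendsto_measure_interference_le (hL : PhysicallyFeasible L) (hH : UnitMeanFading H)
    (hN : ∀ lam : ℝ, 0 < lam → IsCellularNetwork (P lam) lam H (X lam) (h lam)) {a : ℝ}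
    (ha : 0 < a) (haγ : a < 2 * Real.pi * pathLossGamma L) :
    Tendsto (fun lam => (P lam).real
      {ω | interference L (X lam) (h lam) ω ≤ ENNReal.ofReal (a * lam)}) atTop (𝓝 0) := by
  obtain ⟨κ, hκ, hbound⟩ := exists_measure_interference_le hL hH ha haγ
  have hlim : Tendsto (fun lam : ℝ => 2 * Real.exp (-(κ * lam))) atTop (𝓝 0) := by
    have := (Real.tendsto_exp_neg_atTop_nhds_zero.comp
      (tendsto_id.const_mul_atTop hκ)).const_mul 2
    simpa using this
  refine tendsto_of_tendsto_of_tendsto_of_le_of_le' tendsto_const_nhds hlim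
    (Eventually.of_forall fun _ => measureReal_nonneg) ?_
  filter_upwards [eventually_gt_atTop 0] with lam hlam
  exact ENNReal.toReal_le_of_le_ofReal (by positivity)
    (hbound lam hlam.le _ _ _ _ (hN lam hlam))

lemma tendsto_measure_interference_gt (hL : PhysicallyFeasible L) (hH : UnitMeanFading H)
    (hN : ∀ lam : ℝ, 0 < lam → IsCellularNetwork (P lam) lam H (X lam) (h lam)) {b : ℝ}
    (hb : 2 * Real.pi * pathLossGamma L < b) :
    Tendsto (fun lam => (P lam).real
      {ω | ENNReal.ofReal (b * lam) < interference L (X lam) (h lam) ω}) atTop (𝓝 0) := by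
  set G := 2 * Real.pi * pathLossGamma L with hG
  have hG0 : 0 < G := by have := hL.gamma_pos; positivity
  refine tendsto_order.2 ⟨fun c hc => Eventually.of_forall fun _ => hc.trans_le measureReal_nonneg,
    fun ε hε => ?_⟩
  have hεb : 0 < ε * (b - G) / 2 := by have := sub_pos.2 hb; positivity
  -- Half of the budget `ε * (b - G)` goes to `G - a`, the other half to `a` times the lower-tail
  -- probability.
  obtain ⟨a, ha1, ha2⟩ := exists_between (show max 0 (G - ε * (b - G) / 2) < G from
    max_lt hG0 (by linarith))
  have ha0 : 0 < a := (le_max_left _ _).trans_lt ha1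
  have ha3 : G - ε * (b - G) / 2 < a := (le_max_right _ _).trans_lt ha1
  have hV := ((tendsto_measure_interference_le hL hH hN ha0 ha2).const_mul a)
  rw [mul_zero] at hV
  filter_upwards [hV.eventually (gt_mem_nhds hεb), eventually_gt_atTop 0] with lam h1 hlam
  have h2 := (hN lam hlam).measure_interference_gt_le hL hH hlam ha0.le (ha2.trans hb).le
  by_contra hcon
  rw [not_lt] at hcon
  have h3 := mul_le_mul_of_nonneg_left hcon (sub_pos.2 (ha2.trans hb)).le
  nlinarith

lemma tendsto_measure_discBad
    (hN : ∀ lam : ℝ, 0 < lam → IsCellularNetwork (P lam) lam H (X lam) (h lam)) {δ : ℝ}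
    (hδ : 0 < δ) : Tendsto (fun lam => (P lam).real (discBad (X lam) δ)) atTop (𝓝 0) := by
  have hlim : Tendsto (fun lam : ℝ => Real.exp (-(lam * (Real.pi * δ ^ 2)))) atTop (𝓝 0) :=
    Real.tendsto_exp_neg_atTop_nhds_zero.comp
      (tendsto_id.atTop_mul_const (show 0 < Real.pi * δ ^ 2 by positivity))
  refine tendsto_of_tendsto_of_tendsto_of_le_of_le' tendsto_const_nhds hlim
    (Eventually.of_forall fun _ => measureReal_nonneg) ?_
  filter_upwards [eventually_gt_atTop 0] with lam hlam
  exact ENNReal.toReal_le_of_le_ofReal (by positivity)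
    ((hN lam hlam).poisson.measure_discBad_le hlam.le hδ.le)

lemma tendsto_measure_atypical (hL : PhysicallyFeasible L) (hH : UnitMeanFading H)
    (hN : ∀ lam : ℝ, 0 < lam → IsCellularNetwork (P lam) lam H (X lam) (h lam)) {δ a b : ℝ}
    (hδ : 0 < δ) (ha : 0 < a) (haγ : a < 2 * Real.pi * pathLossGamma L)
    (hb : 2 * Real.pi * pathLossGamma L < b) :
    Tendsto (fun lam => (P lam).real (atypical L (X lam) (h lam) lam δ a b)) atTop (𝓝 0) := by
  have hlim := ((tendsto_measure_discBad hN hδ).add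
    (tendsto_measure_interference_le hL hH hN ha haγ)).add
    (tendsto_measure_interference_gt hL hH hN hb)
  rw [add_zero, add_zero] at hlim
  refine tendsto_of_tendsto_of_tendsto_of_le_of_le' tendsto_const_nhds hlim
    (Eventually.of_forall fun _ => measureReal_nonneg) ?_
  filter_upwards [eventually_gt_atTop 0] with lam hlam
  have := (hN lam hlam).isProbabilityMeasure
  exact (measureReal_union_le _ _).trans (by gcongr; exact measureReal_union_le _ _)

/-- Take `a` slightly below `2πγ`. The errors are then of order `lam⁻¹`, by the uniform negative
moment, and `lam ^ 3 * exp (-κ lam)`. -/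
lemma eventually_averageASE_lt (hL : PhysicallyFeasible L) (hcond : SimpleConditions L)
    (hH : UnitMeanFading H)
    (hN : ∀ lam : ℝ, 0 < lam → IsCellularNetwork (P lam) lam H (X lam) (h lam)) (N₀ : ℝ)
    {c : ℝ≥0∞}
    (hc : ENNReal.ofReal (L 0 / (2 * Real.pi * Real.log 2 * pathLossGamma L)) < c) :
    ∀ᶠ lam in atTop, averageASE (P lam) lam L N₀ (X lam) (h lam) < c := by
  have hL0 : 0 ≤ L 0 := hL.nonneg 0 le_rfl
  have hlog2 : 0 < Real.log 2 := Real.log_pos one_lt_two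
  set G := 2 * Real.pi * pathLossGamma L with hG
  have hG0 : 0 < G := by have := hL.gamma_pos; positivity
  have hcont : ContinuousAt (fun a : ℝ => ENNReal.ofReal ((Real.log 2)⁻¹ * (L 0 / a))) G :=
    ENNReal.continuous_ofReal.continuousAt.comp
      (continuousAt_const.mul (continuousAt_const.div continuousAt_id hG0.ne'))
  have hval : ENNReal.ofReal ((Real.log 2)⁻¹ * (L 0 / G)) < c := by
    refine lt_of_eq_of_lt ?_ hc
    rw [hG]
    congr 1
    have := hL.gamma_pos
    field_simp
  have hev := (hcont.eventually (gt_mem_nhds hval)).filter_mono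
    (nhdsWithin_le_nhds (s := Iio G))
  obtain ⟨a, ⟨hac, haG⟩, ha0⟩ := ((hev.and self_mem_nhdsWithin).and
    (nhdsWithin_le_nhds (lt_mem_nhds hG0))).exists
  obtain ⟨κ, hκ, hbound⟩ := exists_measure_interference_le hL hH ha0 haG
  obtain ⟨lam₂, hlam₂, C, hC, hmom⟩ := exists_secondNegativeMoment_le hL hcond hH
  set u : ℝ → ℝ := fun lam => (Real.log 2)⁻¹ * (L 0 / a + (1 + L 0 * (1 + C)) * lam⁻¹ +
    2 * lam ^ 3 * (2 * Real.exp (-(κ * lam)))) with hu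
  have hulim : Tendsto u atTop (𝓝 ((Real.log 2)⁻¹ * (L 0 / a))) := by
    have h1 : Tendsto (fun lam : ℝ => lam ^ 3 * Real.exp (-κ * lam)) atTop (𝓝 0) := by
      simpa using tendsto_rpow_mul_exp_neg_mul_atTop_nhds_zero 3 κ hκ
    have h2 := (((tendsto_const_nhds (x := L 0 / a)).add
      ((tendsto_inv_atTop_zero (𝕜 := ℝ)).const_mul (1 + L 0 * (1 + C)))).add
      (h1.const_mul 4)).const_mul (Real.log 2)⁻¹
    simp only [mul_zero, add_zero] at h2
    refine h2.congr fun lam => ?_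
    simp only [hu, neg_mul]
    ring
  have hulim' := (ENNReal.continuous_ofReal.tendsto _).comp hulim
  filter_upwards [hulim'.eventually (gt_mem_nhds hac), eventually_ge_atTop lam₂] with lam h1 hlam
  refine lt_of_le_of_lt ?_ h1
  have hlam0 : 0 < lam := hlam₂.trans_le hlam
  have hNl := hN lam hlam0
  have := hNl.isProbabilityMeasure
  have hI : ∫⁻ ω, (interference L (X lam) (h lam) ω)⁻¹ ∂(P lam) ≤ ENNReal.ofReal (1 + C) := by
    rw [ENNReal.ofReal_add zero_le_one hC, ENNReal.ofReal_one]
    exact lintegral_inv_interference_le.trans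
      (add_le_add le_rfl (hmom lam hlam _ _ _ _ hNl))
  refine (hNl.averageASE_le hL hH hlam0 ha0 N₀).trans ?_
  simp only [Function.comp_apply, hu]
  rw [ENNReal.ofReal_mul (p := (Real.log 2)⁻¹) (by positivity),
    ENNReal.ofReal_add (by positivity) (by positivity),
    ENNReal.ofReal_add (by positivity) (by positivity),
    ENNReal.ofReal_mul (show 0 ≤ 1 + L 0 * (1 + C) by positivity),
    ENNReal.ofReal_mul (show 0 ≤ 2 * lam ^ 3 by positivity),
    ENNReal.ofReal_add zero_le_one (by positivity), ENNReal.ofReal_one, ENNReal.ofReal_mul hL0]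
  gcongr
  exact hbound lam hlam0.le _ _ _ _ hNl

lemma eventually_lt_averageASE (hL : PhysicallyFeasible L) (hH : UnitMeanFading H)
    (hcont : ContinuousWithinAt L (Ici 0) 0)
    (hN : ∀ lam : ℝ, 0 < lam → IsCellularNetwork (P lam) lam H (X lam) (h lam)) {N₀ : ℝ}
    (hN₀ : 0 ≤ N₀) {c : ℝ≥0∞}
    (hc : c < ENNReal.ofReal (L 0 / (2 * Real.pi * Real.log 2 * pathLossGamma L))) :
    ∀ᶠ lam in atTop, c < averageASE (P lam) lam L N₀ (X lam) (h lam) := by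
  have hlog2 : 0 < Real.log 2 := Real.log_pos one_lt_two
  set G := 2 * Real.pi * pathLossGamma L with hG
  have hG0 : 0 < G := by have := hL.gamma_pos; positivity
  have hL0 : 0 < L 0 := by
    by_contra hcon
    have : L 0 / (2 * Real.pi * Real.log 2 * pathLossGamma L) ≤ 0 :=
      div_nonpos_of_nonpos_of_nonneg (not_lt.1 hcon) (by have := hL.gamma_pos; positivity)
    rw [ENNReal.ofReal_of_nonpos this] at hc
    exact not_lt_zero hc
  have hinv : Tendsto (fun n : ℕ => ((n : ℝ) + 1)⁻¹) atTop (𝓝 0) := by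
    simpa [one_div] using tendsto_one_div_add_atTop_nhds_zero_nat (𝕜 := ℝ)
  -- A single index `n` drives all the approximations: the path loss near the origin, the
  -- interference rate and the truncation of the fading power.
  have hseq : Tendsto (fun n : ℕ => ENNReal.ofReal
      ((L 0 * (1 - ((n : ℝ) + 1)⁻¹)) / ((G + ((n : ℝ) + 1)⁻¹) * Real.log 2) *
        ∫ y, min y n ∂H)) atTop
      (𝓝 (ENNReal.ofReal (L 0 / (2 * Real.pi * Real.log 2 * pathLossGamma L)))) := by
    refine (ENNReal.continuous_ofReal.tendsto _).comp ?_
    have h1 := ((((tendsto_const_nhds (x := (1 : ℝ))).sub hinv).const_mul (L 0)).div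
      (((tendsto_const_nhds (x := G)).add hinv).mul_const (Real.log 2))
      (by rw [add_zero]; positivity)).mul hH.tendsto_integral_min
    have h2 : L 0 / (2 * Real.pi * Real.log 2 * pathLossGamma L) =
        L 0 * (1 - 0) / ((G + 0) * Real.log 2) * 1 := by
      rw [hG]
      ring_nf
    rw [h2]
    exact h1
  obtain ⟨n, hn, hn1⟩ := ((hseq.eventually (lt_mem_nhds hc)).and (eventually_ge_atTop 1)).exists
  set l := L 0 * (1 - ((n : ℝ) + 1)⁻¹) with hl
  set b' := G + ((n : ℝ) + 1)⁻¹ with hb'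
  -- Strictly between `G` and `b'`: above `G` for the upper tail, below `b'` so that `N₀ ≤ (b' - b)
  -- * lam` eventually.
  set b := G + ((n : ℝ) + 1)⁻¹ / 2 with hb
  have hinvpos : 0 < ((n : ℝ) + 1)⁻¹ := by positivity
  have hinv1 : ((n : ℝ) + 1)⁻¹ ≤ 1 := inv_le_one_of_one_le₀ (by linarith [n.cast_nonneg (α := ℝ)])
  have hl0 : 0 ≤ l := mul_nonneg hL0.le (by linarith)
  have hlL : l < L 0 := by rw [hl]; nlinarith
  have hb'0 : 0 < b' := by positivity
  obtain ⟨δ, hδ, hδl⟩ : ∃ δ : ℝ, 0 < δ ∧ ∀ r, 0 ≤ r → r ≤ δ → l ≤ L r := by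
    have h1 := hcont.eventually (lt_mem_nhds hlL)
    obtain ⟨δ, hδ, hsub⟩ := Metric.mem_nhdsWithin_iff.1 h1
    refine ⟨δ / 2, by positivity, fun r hr hrδ => ?_⟩
    have : r ∈ Metric.ball (0 : ℝ) δ ∩ Ici 0 := by
      refine ⟨?_, hr⟩
      rw [mem_ball_zero_iff, Real.norm_of_nonneg hr]
      linarith
    exact (show l < L r from hsub this).le
  have hlim : Tendsto (fun lam : ℝ => ENNReal.ofReal
      ((l / (b' * Real.log 2)) / (1 + n * (l / b') / lam) *
      (∫ y, min y n ∂H - n * (P lam).real (atypical L (X lam) (h lam) lam δ (G / 2) b)))) atTop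
      (𝓝 (ENNReal.ofReal (l / (b' * Real.log 2) * ∫ y, min y n ∂H))) := by
    refine (ENNReal.continuous_ofReal.tendsto _).comp ?_
    have h1 : Tendsto (fun lam : ℝ => 1 + n * (l / b') / lam) atTop (𝓝 (1 + 0)) :=
      tendsto_const_nhds.add (tendsto_const_nhds.div_atTop tendsto_id)
    have h2 := tendsto_measure_atypical hL hH hN hδ (half_pos hG0) (half_lt_self hG0)
      (show G < b by rw [hb]; linarith)
    have h3 := ((tendsto_const_nhds (x := l / (b' * Real.log 2))).div h1 (by simp)).mul
      ((tendsto_const_nhds (x := ∫ y, min y (n : ℝ) ∂H)).sub (h2.const_mul (n : ℝ)))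
    simpa using h3
  have hNbig : ∀ᶠ lam : ℝ in atTop, N₀ / (b' - b) ≤ lam := eventually_ge_atTop _
  have hbb : 0 < b' - b := by rw [hb, hb']; linarith
  filter_upwards [hlim.eventually (lt_mem_nhds hn), hNbig, eventually_gt_atTop 0]
    with lam h1 h2 hlam
  refine h1.trans_le ((hN lam hlam).le_averageASE hL hH hlam hN₀ hl0 hδl (a := G / 2)
    (by positivity) ?_ n.cast_nonneg)
  rw [div_le_iff₀ hbb] at h2
  linarith

end Limit

end UltraDense

end

theorem corollary4 (L : ℝ → ℝ) (hL : UltraDense.PhysicallyFeasible L)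
    (hcond : UltraDense.SimpleConditions L)
    (H : Measure ℝ) (hH : UltraDense.UnitMeanFading H) :
    -- the Laplace-type double integral is finite at all large intensities
    (∃ lamc : ℝ, 0 ≤ lamc ∧ ∀ lam₀ : ℝ, lamc ≤ lam₀ →
      UltraDense.laplaceIntegral L H lam₀ < ∞) ∧
    -- the interference has a finite second negative moment at all large intensities
    (∃ lamc : ℝ, 0 < lamc ∧ ∀ lam₀ : ℝ, lamc ≤ lam₀ →
      ∀ (Ω : Type*) [MeasurableSpace Ω] (P : Measure Ω)
        (X : ℕ → Ω → UltraDense.Plane) (h : ℕ → Ω → ℝ),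
        UltraDense.IsCellularNetwork P lam₀ H X h →
        UltraDense.secondNegativeMoment P L X h < ∞) ∧
    -- the average area spectral efficiency has a limit which does not depend on the fading law
    (ContinuousWithinAt L (Ici 0) 0 →
      ∀ (N₀ : ℝ), 0 ≤ N₀ →
      ∀ (Ω : ℝ → Type*) [∀ lam, MeasurableSpace (Ω lam)] (P : ∀ lam, Measure (Ω lam))
        (X : ∀ lam, ℕ → Ω lam → UltraDense.Plane) (h : ∀ lam, ℕ → Ω lam → ℝ),
        (∀ lam : ℝ, 0 < lam →
          UltraDense.IsCellularNetwork (P lam) lam H (X lam) (h lam)) →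
        Tendsto (fun lam : ℝ => UltraDense.averageASE (P lam) lam L N₀ (X lam) (h lam)) atTop
          (𝓝 (ENNReal.ofReal
            (L 0 / (2 * Real.pi * Real.log 2 * UltraDense.pathLossGamma L))))) := by
  refine ⟨UltraDense.exists_laplaceIntegral_lt_top hL hcond hH, ?_, ?_⟩
  · obtain ⟨lam₂, hlam₂, C, -, hmom⟩ := UltraDense.exists_secondNegativeMoment_le hL hcond hH
    exact ⟨lam₂, hlam₂, fun lam hlam Ω _ P X h hN =>
      (hmom lam hlam Ω P X h hN).trans_lt ENNReal.ofReal_lt_top⟩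
  · intro hcont N₀ hN₀ Ω _ P X h hN
    exact tendsto_order.2
      ⟨fun c hc => UltraDense.eventually_lt_averageASE hL hH hcont hN hN₀ hc,
        fun c hc => UltraDense.eventually_averageASE_lt hL hcond hH hN N₀ hc⟩
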